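/- Let $n\ge 0$ and let $\mathcal{C}\ell_{0,n}$ be the real Clifford algebra with anticommuting generators $i_1,\dots,i_n$, $i_j^2=-1$. Write $x'$ for the grade involution, $x^*$ for reversal, and $\overline{x}=(x')^*$ for Clifford conjugation. Paravectors are the elements $\mathbf X = X_0+\sum_j X_j i_j$ with $X_0,\dots,X_n\in\mathbb R$. Let $\Gamma$ be the group generated by the invertible paravectors. A Lipschitz spinor is a pair $\kappa=(\xi,\eta)\in\mathcal{C}\ell_{0,n}^2$, $\kappa\neq 0$, with $\xi,\eta\in\Gamma\cup\{0\}$ and $\xi\overline{\eta}$ a paravector; $S$ denotes the set of Lipschitz spinors, a submanifold of $\mathcal{C}\ell_{0,n}^2$. Put $\kappa^\dagger=(\overline\xi,\overline\eta)$ for the conjugate transpose and $\check\kappa=(\eta',-\xi')$. Let $\mathbb R^{1,n+2}$ have coordinates $(T,Z;X_0,\dots,X_n)$ and the form $dT^2-dZ^2-dX_0^2-\dots-dX_n^2$, and identify the point $(T,Z;\mathbf X)$ with the matrix $\frac12\begin{pmatrix}T+Z&\mathbf X\\ \overline{\mathbf X}&T-Z\end{pmatrix}$. Let $L^+$ be the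 set of null vectors with $T>0$, so that $T_pL^+=p^\perp$. A null multiflag $[[p;v_1,\dots,v_n]]$ is given by a base-point $p\in L^+$ and pairwise orthogonal vectors $v_j\in T_pL^+$ such that $p,v_1,\dots,v_n$ are linearly independent and $v_1,\dots,v_n$ are positively oriented, i.e. there is a $v_0\in T_pL^+$, orthogonal to all $v_j$, such that $(\partial_T,\,Z\partial_Z+\sum_k X_k\partial_{X_k},\,v_0,v_1,\dots,v_n)$ (the coefficients being the coordinates of $p$) is a positively oriented basis of $\mathbb R^{1,n+2}$. Two such tuples define the same multiflag if they have the same base-point and, for each $j$, the same flag plane $\mathrm{span}(p,v_j)$ with the same orientation of $\mathrm{span}(p,v_j)/\mathbb Rp$ given by the class of $v_j$. Let $\mathcal{MF}^n$ be the bundle over $L^+$ of all null multiflags, with the topology and smooth structure it has as a quotient of the manifold of all tuples $(p;v_1,\dots,v_n)$. Theorem. For $\kappa\in S$ put $\phi_1(\kappa)=\kappa\kappa^\dagger$. Then $\Phi_1(\kappa)=[[\phi_1(\kappa);\,D_\kappa\phi_1(\check\kappa i_1),\dots,D_\kappa\phi_1(\check\kappa i_n)]]$ defines a map $\Phi_1:S\to\mathcal{MF}^n$,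 and $\Phi_1$ is a smooth double cover: it is smooth, and every multiflag has an open neighbourhood whose preimage is a disjoint union of two open sets, each mapped diffeomorphically onto that neighbourhood. Moreover, for $\kappa_1,\kappa_2\in S$, one has $\Phi_1(\kappa_1)=\Phi_1(\kappa_2)$ if and only if $\kappa_2=\pm\kappa_1$. -/

import Mathlib

open scoped ContDiff

namespace LipschitzSpinors

/-! ### The Clifford algebra `Cl_{0,n}` -/

/-- The negative definite quadratic form `-(x₁² + ⋯ + xₙ²)` on `ℝⁿ`. -/
noncomputable def negForm (n : ℕ) : QuadraticForm ℝ (Fin n → ℝ) :=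
  QuadraticMap.weightedSumSquares ℝ (fun _ : Fin n => (-1 : ℝ))

/-- The Clifford algebra `Cl_{0,n}`: generators `i₁, …, iₙ` with `i_j² = -1`, anticommuting. -/
abbrev Cl (n : ℕ) : Type := CliffordAlgebra (negForm n)

/-- The generator `i_j`. -/
noncomputable def gen (n : ℕ) (j : Fin n) : Cl n :=
  CliffordAlgebra.ι (negForm n) (Pi.single j 1)

/-- The grade involution `x ↦ x'`. -/
noncomputable def gradeInv {n : ℕ} (x : Cl n) : Cl n := CliffordAlgebra.involute x

/-- Clifford conjugation `x ↦ x̄` (reversal composed with the grade involution). -/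
noncomputable def conj {n : ℕ} (x : Cl n) : Cl n :=
  CliffordAlgebra.reverse (CliffordAlgebra.involute x)

theorem exteriorAlgebra_finite (n : ℕ) :
    Module.Finite ℝ (ExteriorAlgebra ℝ (Fin n → ℝ)) := by
  have htop : (⨆ i : ℕ, ⋀[ℝ]^i (Fin n → ℝ)) = ⊤ :=
    (DirectSum.Decomposition.isInternal
      (fun i : ℕ => ⋀[ℝ]^i (Fin n → ℝ))).submodule_iSup_eq_top
  have hle : (⨆ i : ℕ, ⋀[ℝ]^i (Fin n → ℝ)) ≤ ⨆ i : Fin (n + 1), ⋀[ℝ]^(i : ℕ) (Fin n → ℝ) := by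
    refine iSup_le fun i => ?_
    by_cases hi : i < n + 1
    · exact le_iSup (fun k : Fin (n + 1) => ⋀[ℝ]^(k : ℕ) (Fin n → ℝ)) ⟨i, hi⟩
    · have h0 : Module.finrank ℝ (⋀[ℝ]^i (Fin n → ℝ)) = 0 := by
        rw [exteriorPower.finrank_eq, Module.finrank_fin_fun]
        exact Nat.choose_eq_zero_of_lt (by omega)
      rw [Submodule.finrank_eq_zero] at h0
      rw [h0]
      exact bot_le
  have h : (⨆ i : Fin (n + 1), ⋀[ℝ]^(i : ℕ) (Fin n → ℝ)) = ⊤ := top_le_iff.mp (htop ▸ hle)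
  have hf : Module.Finite ℝ (⨆ i : Fin (n + 1), ⋀[ℝ]^(i : ℕ) (Fin n → ℝ) : Submodule ℝ _) :=
    inferInstance
  rw [h] at hf
  exact Module.Finite.equiv (Submodule.topEquiv (R := ℝ))

instance cl_finite (n : ℕ) : Module.Finite ℝ (Cl n) :=
  haveI := exteriorAlgebra_finite n
  Module.Finite.equiv (CliffordAlgebra.equivExterior (negForm n)).symm

/-- `Cl_{0,n}` as a normed space, through coordinates in a basis.  As `Cl_{0,n}` has finite
dimension, its topology and its smooth functions do not depend on this choice. -/
noncomputable instance clNormedAddCommGroup (n : ℕ) : NormedAddCommGroup (Cl n) :=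
  NormedAddCommGroup.induced (Cl n) (Fin (Module.finrank ℝ (Cl n)) → ℝ)
    (Module.finBasis ℝ (Cl n)).equivFun (Module.finBasis ℝ (Cl n)).equivFun.injective

noncomputable instance clNormedSpace (n : ℕ) : NormedSpace ℝ (Cl n) :=
  NormedSpace.induced ℝ (Cl n) (Fin (Module.finrank ℝ (Cl n)) → ℝ)
    (Module.finBasis ℝ (Cl n)).equivFun

/-! ### Paravectors, the Lipschitz group, Lipschitz spinors -/

/-- The paravector `x₀ + x₁ i₁ + ⋯ + xₙ iₙ`. -/
noncomputable def paravector {n : ℕ} (x₀ : ℝ) (x : Fin n → ℝ) : Cl n :=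
  algebraMap ℝ (Cl n) x₀ + CliffordAlgebra.ι (negForm n) x

/-- The set of paravectors `ℝ ⊕ ℝ^{0,n} ⊆ Cl_{0,n}`. -/
noncomputable def paravectors (n : ℕ) : Set (Cl n) := {a | ∃ x₀ x, a = paravector x₀ x}

/-- The paravector Lipschitz group: the group generated by the invertible paravectors. -/
noncomputable def lipschitzGroup (n : ℕ) : Subgroup (Cl n)ˣ :=
  Subgroup.closure {u : (Cl n)ˣ | (u : Cl n) ∈ paravectors n}

/-- The Lipschitz monoid: the Lipschitz group together with `0`. -/
noncomputable def lipschitzMonoid (n : ℕ) : Set (Cl n) :=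
  {a | a = 0 ∨ ∃ u ∈ lipschitzGroup n, (u : Cl n) = a}

/-- Lipschitz spinors `κ = (ξ, η)`, as a subset of `Cl_{0,n}²`, with `ξ = κ 0` and `η = κ 1`. -/
noncomputable def spinorSet (n : ℕ) : Set (Fin 2 → Cl n) :=
  {κ | κ 0 ∈ lipschitzMonoid n ∧ κ 1 ∈ lipschitzMonoid n ∧ κ ≠ 0 ∧
    κ 0 * conj (κ 1) ∈ paravectors n}

/-- The complement `(ξ, η) ↦ (η', -ξ')`. -/
noncomputable def check {n : ℕ} (κ : Fin 2 → Cl n) : Fin 2 → Cl n :=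
  ![gradeInv (κ 1), -gradeInv (κ 0)]

/-- The `2 × 2` matrix `κ κ†` (entries `κ_a * conj κ_b`). -/
noncomputable def outer {n : ℕ} (κ : Fin 2 → Cl n) : Fin 2 → Fin 2 → Cl n :=
  fun a b => κ a * conj (κ b)

/-! ### Generalised Minkowski space `ℝ^{1,n+2}` -/

/-- `ℝ^{1,n+2}`, with coordinates in the order `(T, Z, X₀, X₁, …, Xₙ)`. -/
abbrev Mink (n : ℕ) : Type := Fin (n + 3) → ℝ

/-- The Minkowski form `dT² - dZ² - dX₀² - ⋯ - dXₙ²`. -/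
def mink {n : ℕ} (p q : Mink n) : ℝ := p 0 * q 0 - ∑ i : Fin (n + 2), p i.succ * q i.succ

/-- The paravector Hermitian matrix
`½ [T + Z, X; X̄, T - Z]` of a point of `ℝ^{1,n+2}`, where `X = X₀ + ∑ X_j i_j`. -/
noncomputable def hermMatrix {n : ℕ} (p : Mink n) : Fin 2 → Fin 2 → Cl n :=
  let X : Cl n := paravector (p 2) (fun j : Fin n => p j.succ.succ.succ)
  (1 / 2 : ℝ) •
    ![![algebraMap ℝ (Cl n) (p 0 + p 1), X],
      ![conj X, algebraMap ℝ (Cl n) (p 0 - p 1)]]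

/-- The positive light-cone `L⁺`. -/
def posLightCone (n : ℕ) : Set (Mink n) := {p | mink p p = 0 ∧ 0 < p 0}

/-- The tangent space `T_p L⁺ = p^⊥`. -/
def tangentCone {n : ℕ} (p : Mink n) : Set (Mink n) := {v | mink p v = 0}

/-- An ordered `(n+1)`-tuple `(b₀, …, bₙ)` of vectors in `T_p L⁺` represents an outward oriented
basis of `T_p L⁺ / ℝp`: the tuple `(∂_T, ∂_-, b₀, …, bₙ)` is a positively oriented basis
of `ℝ^{1,n+2}`, where `∂_-` is the spatial part of `p`. -/
def OutwardOriented {n : ℕ} (p : Mink n) (b : Fin (n + 1) → Mink n) : Prop :=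
  0 < Matrix.det (Matrix.of (Fin.cons (Pi.single 0 1)
    (Fin.cons (Function.update p 0 0) b : Fin (n + 2) → Mink n) : Fin (n + 3) → Mink n))

/-! ### Null multiflags -/

/-- The data `(p; v₁, …, vₙ)` defining a null multiflag: a base-point `p ∈ L⁺` and mutually
orthogonal flag plane vectors `v_j ∈ T_p L⁺` such that `v₁, …, vₙ, p` are linearly independent,
and which are positively oriented (as `n` vectors in the `(n+1)`-dimensional space `T_p L⁺ / ℝp`:
they are completed by some `v₀` to an outward oriented orthogonal frame `(v₀, v₁, …, vₙ)`). -/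
def frameSet (n : ℕ) : Set (Mink n × (Fin n → Mink n)) :=
  {f | f.1 ∈ posLightCone n ∧ (∀ j, f.2 j ∈ tangentCone f.1) ∧
    (∀ i j, i ≠ j → mink (f.2 i) (f.2 j) = 0) ∧
    LinearIndependent ℝ (Fin.cons f.1 f.2 : Fin (n + 1) → Mink n) ∧
    ∃ v₀ ∈ tangentCone f.1, (∀ j, mink v₀ (f.2 j) = 0) ∧
      OutwardOriented f.1 (Fin.cons v₀ f.2)}

/-- `v` and `w` define the same null flag based at `p`: the flag planes spanned by `p, v` and by
`p, w` agree, and so do the orientations of (flag plane)`/ℝp` given by the classes of `v`, `w`. -/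
def SameFlag {n : ℕ} (p v w : Mink n) : Prop :=
  Submodule.span ℝ {p, v} = Submodule.span ℝ {p, w} ∧
    SameRay ℝ (Submodule.Quotient.mk v : Mink n ⧸ Submodule.span ℝ {p})
      (Submodule.Quotient.mk w)

theorem mk_ne_zero_of_frame {n : ℕ} (f : frameSet n) (j : Fin n) :
    (Submodule.Quotient.mk (f.1.2 j) : Mink n ⧸ Submodule.span ℝ {f.1.1}) ≠ 0 := by
  intro h
  rw [Submodule.Quotient.mk_eq_zero, Submodule.mem_span_singleton] at h
  obtain ⟨a, ha⟩ := h
  have hl := f.2.2.2.2.1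
  have hn := (linearIndependent_finCons.mp hl)
  have hp : f.1.1 ∈ Submodule.span ℝ (Set.range f.1.2) := by
    have ha0 : a ≠ 0 := by
      rintro rfl
      exact hn.1.ne_zero j (by rw [← ha, zero_smul])
    have : f.1.1 = a⁻¹ • f.1.2 j := by rw [← ha, smul_smul, inv_mul_cancel₀ ha0, one_smul]
    rw [this]
    exact Submodule.smul_mem _ _ (Submodule.subset_span ⟨j, rfl⟩)
  exact hn.2 hp

/-- `(p; v₁, …, vₙ)` and `(q; w₁, …, wₙ)` define the same multiflag when they have the same
base-point and, for every `j`, the same `j`-th flag. -/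
instance multiflagSetoid (n : ℕ) : Setoid (frameSet n) where
  r f g := f.1.1 = g.1.1 ∧ ∀ j, SameFlag f.1.1 (f.1.2 j) (g.1.2 j)
  iseqv :=
    { refl := fun f => ⟨rfl, fun j => ⟨rfl, SameRay.refl _⟩⟩
      symm := by
        rintro f g ⟨hp, h⟩
        refine ⟨hp.symm, fun j => ?_⟩
        rw [← hp]
        exact ⟨(h j).1.symm, (h j).2.symm⟩
      trans := by
        rintro f g k ⟨hp, h⟩ ⟨hq, h'⟩
        refine ⟨hp.trans hq, fun j => ?_⟩
        have h1 := h j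
        have h2 := h' j
        have h0 := mk_ne_zero_of_frame g j
        rw [← hp] at h2 h0
        exact ⟨h1.1.trans h2.1, h1.2.trans h2.2 fun h3 => absurd h3 h0⟩ }

/-- The bundle `MF^n` of null multiflags `[[p; v₁, …, vₙ]]`, with the quotient topology
(and below the quotient smooth structure) of the manifold of all `(p; v₁, …, vₙ)`. -/
abbrev Multiflag (n : ℕ) : Type := Quotient (multiflagSetoid n)

/-! ### Smooth maps and smooth double covers -/

/-- A map `f` from the subset `A` of the normed space `E` to the subset `B` of the normed space
`F` is smooth: locally it is the restriction of a smooth map from an open subset of `E` to `F`.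
On embedded submanifolds this is smoothness in the usual sense. -/
def SmoothMap {E F : Type*} [NormedAddCommGroup E] [NormedSpace ℝ E] [NormedAddCommGroup F]
    [NormedSpace ℝ F] {A : Set E} {B : Set F} (f : A → B) : Prop :=
  ∀ x : A, ∃ O : Set E, IsOpen O ∧ (x : E) ∈ O ∧ ∃ g : E → F, ContDiffOn ℝ ∞ g O ∧
    ∀ y : A, (y : E) ∈ O → g y = f y

/-- A map from Lipschitz spinors to multiflags is smooth: locally it is a smooth family of
`(p; v₁, …, vₙ)`, followed by the projection `(p; v₁, …, vₙ) ↦ [[p; v₁, …, vₙ]]`. -/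
def SmoothToMultiflag {n : ℕ} (Φ : spinorSet n → Multiflag n) : Prop :=
  ∀ κ : spinorSet n, ∃ O : Set (Fin 2 → Cl n), IsOpen O ∧ (κ : Fin 2 → Cl n) ∈ O ∧
    ∃ g : (Subtype.val ⁻¹' O : Set (spinorSet n)) → frameSet n,
      SmoothMap (A := spinorSet n ∩ O) (B := frameSet n) (fun x => g ⟨⟨x.1, x.2.1⟩, x.2.2⟩) ∧
      ∀ x, Φ x.1 = ⟦g x⟧

/-- A map `σ` from multiflags to Lipschitz spinors is smooth on the open set `U` of multiflags:
it is smooth as a function of `(p; v₁, …, vₙ)`. -/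
def SmoothOnMultiflag {n : ℕ} (σ : Multiflag n → spinorSet n) (U : Set (Multiflag n)) : Prop :=
  SmoothMap (A := {f | ∃ h : f ∈ frameSet n, (⟦⟨f, h⟩⟧ : Multiflag n) ∈ U}) (B := spinorSet n)
    (fun f => σ ⟦⟨f.1, f.2.1⟩⟧)

/-- `Φ` restricts to a bijection from `V` onto `U` whose inverse is smooth. -/
def HasSmoothInverse {n : ℕ} (Φ : spinorSet n → Multiflag n) (V : Set (spinorSet n))
    (U : Set (Multiflag n)) : Prop :=
  Set.BijOn Φ V U ∧ ∃ σ : Multiflag n → spinorSet n,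
    Set.MapsTo σ U V ∧ Set.InvOn σ Φ V U ∧ SmoothOnMultiflag σ U

/-- `Φ` is a smooth double cover: it is smooth, and every multiflag has an open neighbourhood
whose preimage is the disjoint union of two open sets, each of which is mapped
diffeomorphically onto the neighbourhood. -/
structure IsSmoothDoubleCover {n : ℕ} (Φ : spinorSet n → Multiflag n) : Prop where
  smooth : SmoothToMultiflag Φ
  evenlyCovered : ∀ F : Multiflag n, ∃ U : Set (Multiflag n), IsOpen U ∧ F ∈ U ∧
    ∃ V W : Set (spinorSet n), IsOpen V ∧ IsOpen W ∧ Disjoint V W ∧ V ∪ W = Φ ⁻¹' U ∧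
      HasSmoothInverse Φ V U ∧ HasSmoothInverse Φ W U

/-- The frame `(p; v₁, …, vₙ)` is `(φ₁(κ); Dφ₁(κ̌ i₁), …, Dφ₁(κ̌ iₙ))`, where `φ₁(κ) = κ κ†`
and points and vectors of `ℝ^{1,n+2}` are identified with paravector Hermitian matrices. -/
def IsSpinorFrame {n : ℕ} (κ : spinorSet n) (f : frameSet n) : Prop :=
  hermMatrix f.1.1 = outer κ.1 ∧
    ∀ j, hermMatrix (f.1.2 j) = fderiv ℝ outer κ.1 (fun a => check κ.1 a * gen n j)

end LipschitzSpinors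

open LipschitzSpinors

namespace LipschitzSpinors

/-! ### Involutions, generators and paravectors -/

section Algebra

variable {n : ℕ}

/-! The spatial part of a vector `w = (T, Z; X)` acts on pairs by the traceless matrix `[Z, X; X̄,
-Z]`, called `spinAct n w`. It squares to the Euclidean square length of the spatial part, so pairs
form a Clifford module. Since `κκ†κ = κ(κ†κ)` and `(κ̌ i_j)†κ = 0`, the base-point `p` and the flag
vectors `v_j` of a spinor satisfy equations linear in `κ`: `p` acts on `κ` by the scalar `T`, and
`v_j κ = 2T κ̌ i_j` (`exists_spinorFrame`). Squares and anticommutators of these equations force the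
`v_j` to be orthogonal to `p` and to each other, with length `2T`.

A multiflag has exactly one such representative: take the `T = 0` vector in each flag, scaled to
length `2T` (`flagVec`). The spinors over a multiflag are therefore the Lipschitz solutions of its
linear equations with `κ†κ = T` (`multiflagMap_eq_iff`).

Uniqueness up to sign: if `κ` is a spinor over the multiflag, any other solution is `κ y` with `y
i_j = i_j y'` for all `j`. An element with this property is real (`eq_algebraMap_of_gen_mul`), so
solutions form a real line, and the norm leaves `±κ`.

Existence: the base equation has a solution `(1, W)` or `(0, 1)`, on which the `v_j` act through
orthonormal paravectors. The Lipschitz group is transitive on orthonormal `n`-tuples of paravectors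
(`exists_isLipschitz_of_orthonormal`), so right multiplication by a suitable element turns them into
the generators.

Local sections: the equations describe the common fixed vectors of `n + 1` commuting involutions.
Averaging over these projects a fixed spinor onto the solution line, smoothly in the frame;
rescaling gives a section, and its two signs give the two sheets. -/

@[simp] theorem gradeInv_mul (x y : Cl n) : gradeInv (x * y) = gradeInv x * gradeInv y :=
  map_mul CliffordAlgebra.involute x y

@[simp] theorem gradeInv_add (x y : Cl n) : gradeInv (x + y) = gradeInv x + gradeInv y :=
  map_add CliffordAlgebra.involute x y

@[simp] theorem gradeInv_sub (x y : Cl n) : gradeInv (x - y) = gradeInv x - gradeInv y :=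
  map_sub CliffordAlgebra.involute x y

@[simp] theorem gradeInv_neg (x : Cl n) : gradeInv (-x) = -gradeInv x :=
  map_neg CliffordAlgebra.involute x

@[simp] theorem gradeInv_zero : gradeInv (0 : Cl n) = 0 := map_zero CliffordAlgebra.involute

@[simp] theorem gradeInv_one : gradeInv (1 : Cl n) = 1 := map_one CliffordAlgebra.involute

@[simp] theorem gradeInv_smul (r : ℝ) (x : Cl n) : gradeInv (r • x) = r • gradeInv x :=
  map_smul CliffordAlgebra.involute r x

@[simp] theorem gradeInv_algebraMap (r : ℝ) :
    gradeInv (algebraMap ℝ (Cl n) r) = algebraMap ℝ (Cl n) r :=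
  AlgHom.commutes CliffordAlgebra.involute r

@[simp] theorem gradeInv_gradeInv (x : Cl n) : gradeInv (gradeInv x) = x :=
  CliffordAlgebra.involute_involute x

@[simp] theorem conj_mul (x y : Cl n) : conj (x * y) = conj y * conj x := by
  simp [conj, CliffordAlgebra.reverse.map_mul]

@[simp] theorem conj_add (x y : Cl n) : conj (x + y) = conj x + conj y := by simp [conj]

@[simp] theorem conj_neg (x : Cl n) : conj (-x) = -conj x := by simp [conj]

@[simp] theorem conj_zero : conj (0 : Cl n) = 0 := by simp [conj]

@[simp] theorem conj_one : conj (1 : Cl n) = 1 := by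
  simp [conj, CliffordAlgebra.reverse.map_one]

@[simp] theorem conj_smul (r : ℝ) (x : Cl n) : conj (r • x) = r • conj x := by simp [conj]

@[simp] theorem conj_algebraMap (r : ℝ) :
    conj (algebraMap ℝ (Cl n) r) = algebraMap ℝ (Cl n) r := by
  simp [conj, CliffordAlgebra.reverse.commutes]

@[simp] theorem conj_conj (x : Cl n) : conj (conj x) = x := by
  simp [conj, ← CliffordAlgebra.reverse_involute]

theorem conj_gradeInv (x : Cl n) : conj (gradeInv x) = gradeInv (conj x) := by
  simp [conj, gradeInv, CliffordAlgebra.reverse_involute]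

@[simp] theorem gradeInv_gen (j : Fin n) : gradeInv (gen n j) = -gen n j := by
  simp [gradeInv, gen]

@[simp] theorem conj_gen (j : Fin n) : conj (gen n j) = -gen n j := by simp [conj, gen]

theorem negForm_apply (v : Fin n → ℝ) : negForm n v = -∑ i, v i * v i := by
  simp [negForm, QuadraticMap.weightedSumSquares_apply]

@[simp] theorem gen_mul_gen_self (j : Fin n) : gen n j * gen n j = -1 := by
  rw [gen, CliffordAlgebra.ι_sq_scalar, negForm_apply]
  simp [Pi.single_apply]

theorem polar_negForm (v w : Fin n → ℝ) :
    QuadraticMap.polar (negForm n) v w = -(2 * ∑ i, v i * w i) := by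
  simp only [QuadraticMap.polar, negForm_apply, Pi.add_apply, Finset.mul_sum,
    ← Finset.sum_neg_distrib, ← Finset.sum_sub_distrib]
  exact Finset.sum_congr rfl fun i _ => by ring

theorem gen_mul_gen_of_ne {i j : Fin n} (h : i ≠ j) :
    gen n i * gen n j = -(gen n j * gen n i) := by
  rw [eq_neg_iff_add_eq_zero, gen, gen, CliffordAlgebra.ι_mul_ι_add_swap, polar_negForm]
  simp [Pi.single_apply, h.symm]

theorem algebraMap_injective : Function.Injective (algebraMap ℝ (Cl n)) :=
  (algebraMap ℝ (Cl n)).injective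

theorem paravector_mem (x₀ : ℝ) (x : Fin n → ℝ) : paravector x₀ x ∈ paravectors n :=
  ⟨x₀, x, rfl⟩

theorem paravector_add (x₀ y₀ : ℝ) (x y : Fin n → ℝ) :
    paravector x₀ x + paravector y₀ y = paravector (x₀ + y₀) (x + y) := by
  simp [paravector]; abel

theorem smul_paravector (r x₀ : ℝ) (x : Fin n → ℝ) :
    r • paravector x₀ x = paravector (r * x₀) (r • x) := by
  rw [paravector, paravector, smul_add, map_smul, map_mul, ← Algebra.smul_def]

theorem conj_paravector (x₀ : ℝ) (x : Fin n → ℝ) :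
    conj (paravector x₀ x) = paravector x₀ (-x) := by
  rw [paravector, conj_add, conj_algebraMap]
  simp [paravector, conj]

theorem gradeInv_paravector (x₀ : ℝ) (x : Fin n → ℝ) :
    gradeInv (paravector x₀ x) = paravector x₀ (-x) := by
  rw [paravector, gradeInv_add, gradeInv_algebraMap]
  simp [paravector, gradeInv]

theorem paravector_mul_conj (x₀ : ℝ) (x : Fin n → ℝ) :
    paravector x₀ x * conj (paravector x₀ x) =
      algebraMap ℝ (Cl n) (x₀ * x₀ + ∑ i, x i * x i) := by
  rw [conj_paravector]
  have h := CliffordAlgebra.ι_sq_scalar (negForm n) x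
  rw [negForm_apply] at h
  simp only [paravector, map_neg, mul_add, add_mul, mul_neg, h, map_add, map_mul,
    ← Algebra.commutes x₀ (CliffordAlgebra.ι (negForm n) x)]
  abel

theorem add_mem_paravectors {x y : Cl n} (hx : x ∈ paravectors n) (hy : y ∈ paravectors n) :
    x + y ∈ paravectors n := by
  obtain ⟨a, v, rfl⟩ := hx
  obtain ⟨b, w, rfl⟩ := hy
  rw [paravector_add]
  exact paravector_mem _ _

theorem smul_mem_paravectors (r : ℝ) {x : Cl n} (hx : x ∈ paravectors n) :
    r • x ∈ paravectors n := by
  obtain ⟨a, v, rfl⟩ := hx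
  rw [smul_paravector]
  exact paravector_mem _ _

theorem neg_mem_paravectors {x : Cl n} (hx : x ∈ paravectors n) : -x ∈ paravectors n := by
  simpa using smul_mem_paravectors (-1) hx

theorem sub_mem_paravectors {x y : Cl n} (hx : x ∈ paravectors n) (hy : y ∈ paravectors n) :
    x - y ∈ paravectors n :=
  sub_eq_add_neg x y ▸ add_mem_paravectors hx (neg_mem_paravectors hy)

theorem conj_mem_paravectors {x : Cl n} (hx : x ∈ paravectors n) : conj x ∈ paravectors n := by
  obtain ⟨a, v, rfl⟩ := hx
  rw [conj_paravector]
  exact paravector_mem _ _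

theorem gradeInv_eq_conj {x : Cl n} (hx : x ∈ paravectors n) : gradeInv x = conj x := by
  obtain ⟨a, v, rfl⟩ := hx
  rw [conj_paravector, gradeInv_paravector]

theorem algebraMap_mem_paravectors (r : ℝ) : algebraMap ℝ (Cl n) r ∈ paravectors n :=
  ⟨r, 0, by simp [paravector]⟩

theorem zero_mem_paravectors : (0 : Cl n) ∈ paravectors n := by
  simpa using algebraMap_mem_paravectors (n := n) 0

theorem gen_mem_paravectors (j : Fin n) : gen n j ∈ paravectors n :=
  ⟨0, Pi.single j 1, by simp [paravector, gen]⟩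

/-- A paravector has a nonnegative real square norm, which vanishes at zero only. -/
theorem exists_normSq {x : Cl n} (hx : x ∈ paravectors n) :
    ∃ r : ℝ, x * conj x = algebraMap ℝ (Cl n) r ∧ conj x * x = algebraMap ℝ (Cl n) r ∧
      0 ≤ r ∧ (x ≠ 0 → 0 < r) := by
  obtain ⟨a, v, rfl⟩ := hx
  have h0 : 0 ≤ ∑ i, v i * v i := Finset.sum_nonneg fun i _ => mul_self_nonneg _
  refine ⟨a * a + ∑ i, v i * v i, paravector_mul_conj a v, ?_, ?_, fun hne => ?_⟩
  · have := paravector_mul_conj a (-v)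
    rw [← conj_paravector, conj_conj] at this
    simpa using this
  · exact add_nonneg (mul_self_nonneg a) h0
  · by_contra hle
    have ha : a * a = 0 := le_antisymm (by nlinarith) (mul_self_nonneg a)
    have hv : ∑ i, v i * v i = 0 := le_antisymm (by nlinarith [mul_self_nonneg a]) h0
    rw [Finset.sum_eq_zero_iff_of_nonneg fun i _ => mul_self_nonneg _] at hv
    have hv0 : v = 0 := funext fun i => mul_self_eq_zero.mp (hv i (Finset.mem_univ i))
    exact hne (by simp [paravector, mul_self_eq_zero.mp ha, hv0])

/-- Polarisation of the square norm. -/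
theorem exists_mul_add_conj {x y : Cl n} (hx : x ∈ paravectors n) (hy : y ∈ paravectors n) :
    ∃ r : ℝ, x * y + conj (x * y) = algebraMap ℝ (Cl n) r := by
  obtain ⟨a, ha, -⟩ := exists_normSq hx
  obtain ⟨b, -, hb, -⟩ := exists_normSq hy
  -- The cross terms of the square norm of `x + ȳ` are `x * y` and its conjugate.
  obtain ⟨c, hc, -⟩ := exists_normSq (add_mem_paravectors hx (conj_mem_paravectors hy))
  refine ⟨c - a - b, ?_⟩
  rw [map_sub, map_sub, ← ha, ← hb, ← hc]
  simp only [conj_add, conj_conj, conj_mul]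
  noncomm_ring

/-- Paravectors are stable under `x ↦ y * x * y`. -/
theorem mul_mul_mem_paravectors {x y : Cl n} (hx : x ∈ paravectors n) (hy : y ∈ paravectors n) :
    y * x * y ∈ paravectors n := by
  obtain ⟨r, hr⟩ := exists_mul_add_conj hy hx
  obtain ⟨s, -, hs, -⟩ := exists_normSq hy
  -- With `y x + x̄ ȳ = r` and `ȳ y = s`, both real, `y x y = r y - x̄ ȳ y`: up to conjugation, a
  -- reflection.
  have h : y * x * y = r • y - s • conj x := by
    rw [Algebra.smul_def, Algebra.smul_def, ← hr, Algebra.commutes, ← hs, conj_mul]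
    noncomm_ring
  rw [h]
  exact sub_mem_paravectors (smul_mem_paravectors r hy)
    (smul_mem_paravectors s (conj_mem_paravectors hx))

end Algebra

/-! ### The twisted centre of the Clifford algebra -/

section Centre

variable {n : ℕ}

/-- The twisted commutator with a vector and contraction are both twisted derivations, and they
agree on generators by the Clifford relation. This turns commutation conditions into vanishing
contractions. -/
theorem ι_mul_sub_involute_mul_ι (v : Fin n → ℝ) (x : Cl n) :
    CliffordAlgebra.ι (negForm n) v * x -
        CliffordAlgebra.involute x * CliffordAlgebra.ι (negForm n) v =
      CliffordAlgebra.contractLeft (QuadraticMap.polarBilin (negForm n) v) x := by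
  induction x using CliffordAlgebra.left_induction with
  | algebraMap r =>
    rw [CliffordAlgebra.contractLeft_algebraMap, AlgHom.commutes, Algebra.commutes, sub_self]
  | add x y hx hy =>
    rw [map_add, map_add, ← hx, ← hy]
    noncomm_ring
  | ι_mul x w hx =>
    rw [CliffordAlgebra.contractLeft_ι_mul, ← hx, map_mul, CliffordAlgebra.involute_ι,
      QuadraticMap.polarBilin_apply_apply, Algebra.smul_def,
      ← CliffordAlgebra.ι_mul_ι_add_swap]
    noncomm_ring

/-- An element of the exterior algebra all of whose contractions vanish is a scalar. -/
theorem exteriorAlgebra_eq_algebraMap_of_contractLeft (x : ExteriorAlgebra ℝ (Fin n → ℝ))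
    (h : ∀ j : Fin n, CliffordAlgebra.contractLeft (LinearMap.proj j) x = 0) :
    ∃ r : ℝ, x = algebraMap ℝ _ r := by
  -- The number operator: it acts on the `k`-th exterior power as multiplication by `k`. Vanishing
  -- contractions make it kill `x`, which leaves only the component of degree `0`.
  let N : Module.End ℝ (ExteriorAlgebra ℝ (Fin n → ℝ)) := ∑ j : Fin n,
    (LinearMap.mulLeft ℝ (ExteriorAlgebra.ι ℝ (Pi.single j 1))).comp
      (CliffordAlgebra.contractLeft (LinearMap.proj j))
  have hN : ∀ (v : Fin n → ℝ) (y : ExteriorAlgebra ℝ (Fin n → ℝ)),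
      N (ExteriorAlgebra.ι ℝ v * y) =
        ExteriorAlgebra.ι ℝ v * y + ExteriorAlgebra.ι ℝ v * N y := by
    intro v y
    have hv : ∑ j, v j • ExteriorAlgebra.ι ℝ (Pi.single j 1) = ExteriorAlgebra.ι ℝ v := by
      conv_rhs => rw [pi_eq_sum_univ' v, map_sum]
      refine Finset.sum_congr rfl fun j _ => ?_
      rw [map_smul]
    simp only [N, LinearMap.sum_apply, LinearMap.comp_apply, LinearMap.mulLeft_apply]
    rw [Finset.mul_sum]
    nth_rewrite 2 [← hv]
    rw [Finset.sum_mul, ← Finset.sum_add_distrib]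
    refine Finset.sum_congr rfl fun j _ => ?_
    have h1 : CliffordAlgebra.contractLeft (LinearMap.proj j) (ExteriorAlgebra.ι ℝ v * y) =
        v j • y - ExteriorAlgebra.ι ℝ v * CliffordAlgebra.contractLeft (LinearMap.proj j) y :=
      CliffordAlgebra.contractLeft_ι_mul _ _ _
    have h2 : ExteriorAlgebra.ι ℝ (Pi.single j (1 : ℝ)) * ExteriorAlgebra.ι ℝ v =
        -(ExteriorAlgebra.ι ℝ v * ExteriorAlgebra.ι ℝ (Pi.single j (1 : ℝ))) :=
      eq_neg_of_add_eq_zero_left (ExteriorAlgebra.ι_add_mul_swap _ _)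
    rw [h1, mul_sub, ← mul_assoc, h2, mul_smul_comm, smul_mul_assoc, neg_mul, sub_neg_eq_add,
      mul_assoc]
  have hdeg : ∀ (k : ℕ) (y : ExteriorAlgebra ℝ (Fin n → ℝ)), y ∈ ⋀[ℝ]^k (Fin n → ℝ) →
      N y = (k : ℝ) • y := by
    intro k
    induction k with
    | zero =>
      intro y hy
      change y ∈ (LinearMap.range (ExteriorAlgebra.ι ℝ : (Fin n → ℝ) →ₗ[ℝ] _)) ^ 0 at hy
      rw [pow_zero, Submodule.mem_one] at hy
      obtain ⟨r, rfl⟩ := hy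
      have h0 : ∀ j : Fin n, CliffordAlgebra.contractLeft (LinearMap.proj j)
          (algebraMap ℝ (ExteriorAlgebra ℝ (Fin n → ℝ)) r) = 0 := fun j =>
        CliffordAlgebra.contractLeft_algebraMap _ _ _
      simp [N, h0]
    | succ k ih =>
      intro y hy
      change y ∈ (LinearMap.range (ExteriorAlgebra.ι ℝ : (Fin n → ℝ) →ₗ[ℝ] _)) ^ (k + 1) at hy
      rw [pow_succ'] at hy
      induction hy using Submodule.mul_induction_on' with
      | mem_mul_mem a ha b hb =>
        obtain ⟨v, rfl⟩ := ha
        rw [hN, ih b hb, mul_smul_comm, Nat.cast_succ, add_smul, one_smul, add_comm]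
      | add a _ b _ ha hb => rw [map_add, ha, hb, smul_add]
  have hNx : N x = 0 := by simp [N, h]
  let A : ℕ → Submodule ℝ (ExteriorAlgebra ℝ (Fin n → ℝ)) := fun k => ⋀[ℝ]^k (Fin n → ℝ)
  have hcomp : ∀ (i : ℕ) (y : ExteriorAlgebra ℝ (Fin n → ℝ)),
      (DirectSum.decompose A (N y) i : ExteriorAlgebra ℝ (Fin n → ℝ)) =
        (i : ℝ) • (DirectSum.decompose A y i : ExteriorAlgebra ℝ (Fin n → ℝ)) := by
    intro i y
    induction y using DirectSum.Decomposition.inductionOn A with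
    | zero => simp
    | @homogeneous j m =>
      rw [hdeg j m m.2, DirectSum.decompose_smul, DirectSum.smul_apply, Submodule.coe_smul]
      by_cases hij : j = i
      · subst hij
        rfl
      · rw [DirectSum.decompose_of_mem_ne A m.2 hij, smul_zero, smul_zero]
    | add a b ha hb =>
      simp only [map_add, DirectSum.decompose_add, DirectSum.add_apply, Submodule.coe_add,
        ha, hb, smul_add]
  have hz : ∀ i ≠ 0, (DirectSum.decompose A x i : ExteriorAlgebra ℝ (Fin n → ℝ)) = 0 := by
    intro i hi
    have h1 := hcomp i x
    rw [hNx, DirectSum.decompose_zero, DirectSum.zero_apply, Submodule.coe_zero, eq_comm,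
      smul_eq_zero] at h1
    exact h1.resolve_left (by exact_mod_cast hi)
  classical
  have hx : x = DirectSum.decompose A x 0 := by
    conv_lhs => rw [← DirectSum.sum_support_decompose A x]
    refine Finset.sum_eq_single 0 (fun i _ hi => hz i hi) fun h0 => ?_
    simpa [DFinsupp.notMem_support_iff] using h0
  have hmem := (DirectSum.decompose A x 0).2
  rw [← hx] at hmem
  change x ∈ (LinearMap.range (ExteriorAlgebra.ι ℝ : (Fin n → ℝ) →ₗ[ℝ] _)) ^ 0 at hmem
  rw [pow_zero, Submodule.mem_one] at hmem
  obtain ⟨r, hr⟩ := hmem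
  exact ⟨r, hr.symm⟩

/-- An element `x` with `x e_j = e_j x'` for all `j` is real. -/
theorem eq_algebraMap_of_gen_mul (x : Cl n) (h : ∀ j, x * gen n j = gen n j * gradeInv x) :
    ∃ r : ℝ, x = algebraMap ℝ _ r := by
  have h1 : ∀ j : Fin n, CliffordAlgebra.contractLeft (LinearMap.proj j) (gradeInv x) = 0 := by
    intro j
    have h2 := ι_mul_sub_involute_mul_ι (Pi.single j (1 : ℝ)) (gradeInv x)
    have h3 := h j
    rw [gen] at h3
    have h4 : QuadraticMap.polarBilin (negForm n) (Pi.single j (1 : ℝ)) =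
        (-2 : ℝ) • (LinearMap.proj j : (Fin n → ℝ) →ₗ[ℝ] ℝ) := by
      ext i
      simp [polar_negForm, Pi.single_apply, eq_comm]
    rw [h4, map_smul, LinearMap.smul_apply, ← h3] at h2
    have h5 : CliffordAlgebra.involute (gradeInv x) = x := gradeInv_gradeInv x
    rw [h5, sub_self, eq_comm, smul_eq_zero] at h2
    exact h2.resolve_left (by norm_num)
  -- The linear isomorphism with the exterior algebra commutes with contractions and fixes scalars,
  -- so the exterior statement transfers.
  obtain ⟨r, hr⟩ := exteriorAlgebra_eq_algebraMap_of_contractLeft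
    (CliffordAlgebra.equivExterior (negForm n) (gradeInv x)) fun j => by
      have h2 := CliffordAlgebra.changeForm_contractLeft
        (CliffordAlgebra.changeForm.associated_neg_proof (Q := negForm n))
        (LinearMap.proj j) (gradeInv x)
      rw [h1 j, map_zero] at h2
      exact h2.symm
  have h6 : gradeInv x = algebraMap ℝ (Cl n) r := by
    apply (CliffordAlgebra.equivExterior (negForm n)).injective
    rw [hr]
    exact (CliffordAlgebra.changeForm_algebraMap
      (CliffordAlgebra.changeForm.associated_neg_proof (Q := negForm n)) r).symm
  refine ⟨r, ?_⟩
  rw [← gradeInv_gradeInv x, h6, gradeInv_algebraMap]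

end Centre
end LipschitzSpinors
namespace LipschitzSpinors

/-! ### The Lipschitz group -/

section Lipschitz

variable {n : ℕ}

/-- The elements of the paravector Lipschitz group, as elements of the Clifford algebra. -/
def IsLipschitz (x : Cl n) : Prop := ∃ u ∈ lipschitzGroup n, (u : Cl n) = x

theorem IsLipschitz.mul {x y : Cl n} (hx : IsLipschitz x) (hy : IsLipschitz y) :
    IsLipschitz (x * y) := by
  obtain ⟨u, hu, rfl⟩ := hx
  obtain ⟨v, hv, rfl⟩ := hy
  exact ⟨u * v, mul_mem hu hv, rfl⟩

theorem IsLipschitz.ne_zero {x : Cl n} (hx : IsLipschitz x) : x ≠ 0 := by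
  obtain ⟨u, -, rfl⟩ := hx
  exact u.ne_zero

theorem isLipschitz_of_mem_paravectors {x : Cl n} (hx : x ∈ paravectors n) (h0 : x ≠ 0) :
    IsLipschitz x := by
  obtain ⟨r, h1, h2, -, hr⟩ := exists_normSq hx
  have hr := (hr h0).ne'
  have h3 : r⁻¹ • algebraMap ℝ (Cl n) r = 1 := by
    rw [Algebra.smul_def, ← map_mul, inv_mul_cancel₀ hr, map_one]
  exact ⟨⟨x, r⁻¹ • conj x, by rw [mul_smul_comm, h1, h3], by rw [smul_mul_assoc, h2, h3]⟩,
    Subgroup.subset_closure hx, rfl⟩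

theorem isLipschitz_one : IsLipschitz (1 : Cl n) := ⟨1, one_mem _, rfl⟩

theorem IsLipschitz.smul {x : Cl n} (hx : IsLipschitz x) {r : ℝ} (hr : r ≠ 0) :
    IsLipschitz (r • x) := by
  rw [Algebra.smul_def]
  exact (isLipschitz_of_mem_paravectors (algebraMap_mem_paravectors r)
    (by simpa using hr)).mul hx

theorem IsLipschitz.exists_normSq {x : Cl n} (hx : IsLipschitz x) :
    ∃ r : ℝ, 0 < r ∧ x * conj x = algebraMap ℝ (Cl n) r ∧
      conj x * x = algebraMap ℝ (Cl n) r := by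
  obtain ⟨u, hu, rfl⟩ := hx
  induction hu using Subgroup.closure_induction with
  | mem u hu =>
    obtain ⟨r, h1, h2, -, h3⟩ := LipschitzSpinors.exists_normSq hu
    exact ⟨r, h3 u.ne_zero, h1, h2⟩
  | one => exact ⟨1, one_pos, by simp, by simp⟩
  | mul u v _ _ hu hv =>
    obtain ⟨r, hr, h1, h2⟩ := hu
    obtain ⟨s, hs, h3, h4⟩ := hv
    refine ⟨r * s, mul_pos hr hs, ?_, ?_⟩
    · rw [Units.val_mul, conj_mul, mul_assoc, ← mul_assoc _ (conj (v : Cl n)), h3,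
        Algebra.commutes, ← mul_assoc, h1, map_mul]
    · rw [Units.val_mul, conj_mul, mul_assoc, ← mul_assoc (conj (u : Cl n)), h2,
        Algebra.commutes, ← mul_assoc, h4, map_mul, Algebra.commutes]
  | inv u _ hu =>
    obtain ⟨r, hr, h1, h2⟩ := hu
    have hr' : r⁻¹ • algebraMap ℝ (Cl n) r = 1 := by
      rw [Algebra.smul_def, ← map_mul, inv_mul_cancel₀ hr.ne', map_one]
    have h3 : ((u⁻¹ : (Cl n)ˣ) : Cl n) = r⁻¹ • conj (u : Cl n) := by
      rw [Units.inv_eq_of_mul_eq_one_right]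
      rw [mul_smul_comm, h1, hr']
    refine ⟨r⁻¹, inv_pos.mpr hr, ?_, ?_⟩ <;>
    simp only [h3, conj_smul, conj_conj, smul_mul_assoc, mul_smul_comm, h1, h2,
      Algebra.algebraMap_eq_smul_one, smul_smul, inv_mul_cancel₀ hr.ne', mul_one]

/-- The two memberships are proved together because `u⁻¹` is a positive multiple of `conj u`, so
passing to inverses exchanges them. -/
theorem IsLipschitz.mul_mul_mem {x y : Cl n} (hx : IsLipschitz x) (hy : y ∈ paravectors n) :
    x * y * conj (gradeInv x) ∈ paravectors n ∧ conj x * y * gradeInv x ∈ paravectors n := by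
  obtain ⟨u, hu, rfl⟩ := hx
  induction hu using Subgroup.closure_induction generalizing y with
  | mem u hu =>
    have hu : (u : Cl n) ∈ paravectors n := hu
    rw [gradeInv_eq_conj hu, conj_conj]
    exact ⟨mul_mul_mem_paravectors hy hu,
      mul_mul_mem_paravectors hy (conj_mem_paravectors hu)⟩
  | one => simpa using hy
  | mul u v _ _ hu hv =>
    refine ⟨?_, ?_⟩
    · simpa only [Units.val_mul, gradeInv_mul, conj_mul, mul_assoc] using (hu (hv hy).1).1
    · simpa only [Units.val_mul, gradeInv_mul, conj_mul, mul_assoc] using (hv (hu hy).2).2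
  | inv u hmem hu =>
    obtain ⟨r, hr, h1, h2⟩ := IsLipschitz.exists_normSq ⟨u, hmem, rfl⟩
    have h3 : ((u⁻¹ : (Cl n)ˣ) : Cl n) = r⁻¹ • conj (u : Cl n) := by
      rw [Units.inv_eq_of_mul_eq_one_right]
      rw [mul_smul_comm, h1, Algebra.smul_def, ← map_mul, inv_mul_cancel₀ hr.ne', map_one]
    have h4 := hu hy
    rw [h3]
    simp only [gradeInv_smul, conj_smul, conj_conj, ← conj_gradeInv, smul_mul_assoc,
      mul_smul_comm]
    exact ⟨smul_mem_paravectors _ (smul_mem_paravectors _ h4.2),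
      smul_mem_paravectors _ (smul_mem_paravectors _ h4.1)⟩

theorem mul_mem_lipschitzMonoid {x y : Cl n} (hx : x ∈ paravectors n) (hy : IsLipschitz y) :
    x * y ∈ lipschitzMonoid n := by
  by_cases h0 : x = 0
  · exact Or.inl (by rw [h0, zero_mul])
  · exact Or.inr ((isLipschitz_of_mem_paravectors hx h0).mul hy)

/-- A rotor that fixes all generators preceding `e_k` and sends `e_k` to `a`. -/
theorem exists_rotor {a : Cl n} (ha : a ∈ paravectors n) (ha1 : a * conj a = 1) (k : Fin n)
    (h : ∀ j < k, gen n j * conj a + a * conj (gen n j) = 0) :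
    ∃ ρ : Cl n, IsLipschitz ρ ∧ (∀ j < k, ρ * gen n j = gen n j * gradeInv ρ) ∧
      ρ * gen n k = a * gradeInv ρ := by
  have hek : IsLipschitz (gen n k) := isLipschitz_of_mem_paravectors (gen_mem_paravectors k)
    fun h0 => by simpa [h0] using gen_mul_gen_self k
  -- The rotation taking `e_k` to `a` comes from the bisector: `ρ = (a + e_k) e_k`. It degenerates
  -- only at `a = -e_k`, where `e_k` itself serves.
  by_cases hak : a + gen n k = 0
  · refine ⟨gen n k, hek, fun j hj => ?_, ?_⟩
    · rw [gen_mul_gen_of_ne hj.ne', gradeInv_gen, mul_neg]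
    · rw [eq_neg_of_add_eq_zero_left hak, gradeInv_gen, neg_mul_neg]
  · have hm := add_mem_paravectors ha (gen_mem_paravectors k)
    refine ⟨(a + gen n k) * gen n k, (isLipschitz_of_mem_paravectors hm hak).mul hek,
      fun j hj => ?_, ?_⟩
    · have h1 := h j hj
      have h2 : a * gen n j = gen n j * conj a := by
        rw [conj_gen, mul_neg, add_neg_eq_zero] at h1
        exact h1.symm
      have h3 : (a + gen n k) * gen n j = gen n j * (conj a - gen n k) := by
        rw [add_mul, h2, gen_mul_gen_of_ne hj.ne', mul_sub, sub_eq_add_neg]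
      rw [gradeInv_mul, gradeInv_eq_conj hm, gradeInv_gen, mul_assoc,
        gen_mul_gen_of_ne hj.ne', conj_add, conj_gen, mul_neg, mul_neg, mul_neg, ← mul_assoc,
        ← mul_assoc, h3, sub_eq_add_neg]
    · rw [gradeInv_mul, gradeInv_eq_conj hm, gradeInv_gen, mul_assoc, gen_mul_gen_self,
        conj_add, conj_gen, ← mul_assoc, mul_add, ha1]
      simp only [add_mul, mul_neg, neg_mul, one_mul, mul_one, mul_assoc, gen_mul_gen_self]
      abel

/-- The Lipschitz group acts transitively on orthonormal `n`-tuples of paravectors. -/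
theorem exists_isLipschitz_of_orthonormal (m : Fin n → Cl n) (hm : ∀ j, m j ∈ paravectors n)
    (h1 : ∀ j, m j * conj (m j) = 1)
    (h2 : ∀ i j, i ≠ j → m i * conj (m j) + m j * conj (m i) = 0) :
    ∃ ζ : Cl n, IsLipschitz ζ ∧ ∀ j, ζ * gen n j = m j * gradeInv ζ := by
  -- Vectors are aligned one at a time; each new rotor must leave the earlier ones in place.
  suffices h : ∀ k : ℕ, k ≤ n → ∃ ζ : Cl n, IsLipschitz ζ ∧
      ∀ j : Fin n, (j : ℕ) < k → ζ * gen n j = m j * gradeInv ζ by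
    obtain ⟨ζ, h3, h4⟩ := h n le_rfl
    exact ⟨ζ, h3, fun j => h4 j j.2⟩
  intro k
  induction k with
  | zero => exact fun _ => ⟨1, isLipschitz_one, fun j hj => absurd hj (Nat.not_lt_zero _)⟩
  | succ k ih =>
    intro hk
    obtain ⟨ζ, hζ, hj⟩ := ih (by omega)
    obtain ⟨r, hr, hr1, hr2⟩ := hζ.exists_normSq
    let k' : Fin n := ⟨k, hk⟩
    have hr3 : gradeInv ζ * conj (gradeInv ζ) = algebraMap ℝ (Cl n) r := by
      rw [conj_gradeInv, ← gradeInv_mul, hr1, gradeInv_algebraMap]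
    have hr4 : r⁻¹ • algebraMap ℝ (Cl n) r = 1 := by
      rw [Algebra.smul_def, ← map_mul, inv_mul_cancel₀ hr.ne', map_one]
    have hinv : ∀ x y : Cl n, ζ * x = y ↔ x = r⁻¹ • (conj ζ * y) := by
      refine fun x y => ⟨fun h => ?_, fun h => ?_⟩
      · rw [← h, ← mul_assoc, hr2, ← smul_mul_assoc, hr4, one_mul]
      · rw [h, mul_smul_comm, ← mul_assoc, hr1, ← smul_mul_assoc, hr4, one_mul]
    -- The twisted action `x ↦ ζ⁻¹ x ζ'` preserves the paravector inner product, so the pulled-back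
    -- tuple stays orthonormal.
    have hact : ∀ x y : Cl n, (r⁻¹ • (conj ζ * (x * gradeInv ζ))) *
        conj (r⁻¹ • (conj ζ * (y * gradeInv ζ))) = r⁻¹ • (conj ζ * (x * conj y) * ζ) := by
      intro x y
      simp only [conj_smul, conj_mul, conj_conj, smul_mul_assoc, mul_smul_comm]
      congr 1
      calc r⁻¹ • (conj ζ * (x * gradeInv ζ) * (conj (gradeInv ζ) * conj y * ζ))
          = r⁻¹ • (conj ζ * x * (gradeInv ζ * conj (gradeInv ζ)) * conj y * ζ) := by
            simp only [mul_assoc]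
        _ = (r⁻¹ • algebraMap ℝ (Cl n) r) * (conj ζ * x * conj y * ζ) := by
            rw [hr3, ← Algebra.commutes]
            simp only [smul_mul_assoc, mul_assoc]
        _ = conj ζ * (x * conj y) * ζ := by
            rw [hr4, one_mul]
            simp only [mul_assoc]
    have hgen : ∀ j : Fin n, (j : ℕ) < k → gen n j = r⁻¹ • (conj ζ * (m j * gradeInv ζ)) :=
      fun j hjk => (hinv _ _).mp (hj j hjk)
    -- The next vector, pulled back by `ζ`, is a unit paravector orthogonal to the generators
    -- already aligned; `ρ` rotates `e_k` onto it while fixing those.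
    obtain ⟨ρ, hρ, h3, h4⟩ := exists_rotor (a := r⁻¹ • (conj ζ * (m k' * gradeInv ζ)))
      (smul_mem_paravectors _ (by
        simpa only [mul_assoc] using (hζ.mul_mul_mem (hm k')).2))
      (by rw [hact, h1, mul_one, hr2, hr4]) k' (by
        intro j hjk
        have hjk' : (j : ℕ) < k := hjk
        rw [hgen j hjk', hact, hact, ← smul_add, ← add_mul, ← mul_add,
          h2 j k' (ne_of_lt hjk), mul_zero, zero_mul, smul_zero])
    refine ⟨ζ * ρ, hζ.mul hρ, fun j hjk => ?_⟩
    rcases Nat.lt_succ_iff_lt_or_eq.mp hjk with hlt | heq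
    · rw [mul_assoc, h3 j hlt, ← mul_assoc, hj j hlt, gradeInv_mul, mul_assoc]
    · obtain rfl : j = k' := Fin.ext heq
      rw [mul_assoc, h4, ← mul_assoc, (hinv _ _).mpr rfl, gradeInv_mul, mul_assoc]

end Lipschitz
end LipschitzSpinors
namespace LipschitzSpinors

/-! ### The action of Minkowski space on pairs -/

section Action

variable {n : ℕ}

/-- The paravector part `X` of a point `(T, Z; X)`, as a linear map. -/
noncomputable def paraPart (n : ℕ) : Mink n →ₗ[ℝ] Cl n :=
  (Algebra.linearMap ℝ (Cl n)).comp (LinearMap.proj 2) +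
    (CliffordAlgebra.ι (negForm n)).comp
      (LinearMap.funLeft ℝ ℝ fun j : Fin n => (j.succ.succ.succ : Fin (n + 3)))

theorem paraPart_apply (w : Mink n) :
    paraPart n w = paravector (w 2) (fun j : Fin n => w j.succ.succ.succ) := rfl

theorem paraPart_mem (w : Mink n) : paraPart n w ∈ paravectors n := ⟨_, _, rfl⟩

/-- The Euclidean inner product of the spatial parts. -/
def spatialDot (v w : Mink n) : ℝ := ∑ i : Fin (n + 2), v i.succ * w i.succ

theorem mink_eq (v w : Mink n) : mink v w = v 0 * w 0 - spatialDot v w := rfl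

theorem spatialDot_comm (v w : Mink n) : spatialDot v w = spatialDot w v :=
  Finset.sum_congr rfl fun _ _ => mul_comm _ _

theorem spatialDot_add_left (u v w : Mink n) :
    spatialDot (u + v) w = spatialDot u w + spatialDot v w := by
  simp [spatialDot, add_mul, Finset.sum_add_distrib]

theorem spatialDot_smul_left (r : ℝ) (v w : Mink n) :
    spatialDot (r • v) w = r * spatialDot v w := by
  simp [spatialDot, Finset.mul_sum, mul_assoc]

theorem spatialDot_add_right (u v w : Mink n) :
    spatialDot u (v + w) = spatialDot u v + spatialDot u w := by
  rw [spatialDot_comm, spatialDot_add_left, spatialDot_comm v, spatialDot_comm w]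

theorem spatialDot_smul_right (r : ℝ) (v w : Mink n) :
    spatialDot v (r • w) = r * spatialDot v w := by
  rw [spatialDot_comm, spatialDot_smul_left, spatialDot_comm]

/-- `spatialDot` as a bilinear form. -/
noncomputable def spatialForm (n : ℕ) : LinearMap.BilinForm ℝ (Mink n) :=
  LinearMap.mk₂ ℝ spatialDot spatialDot_add_left (fun r v w => spatialDot_smul_left r v w)
    spatialDot_add_right (fun r v w => spatialDot_smul_right r v w)

theorem spatialDot_self_nonneg (v : Mink n) : 0 ≤ spatialDot v v :=
  Finset.sum_nonneg fun _ _ => mul_self_nonneg _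

theorem spatialDot_self_eq_zero {v : Mink n} (h : spatialDot v v = 0) (i : Fin (n + 2)) :
    v i.succ = 0 := by
  rw [spatialDot, Finset.sum_eq_zero_iff_of_nonneg fun _ _ => mul_self_nonneg _] at h
  exact mul_self_eq_zero.mp (h i (Finset.mem_univ i))

theorem eq_of_spatialDot_sub_self {v w : Mink n} (h : spatialDot (v - w) (v - w) = 0)
    (h0 : v 0 = w 0) : v = w := by
  funext i
  refine Fin.cases h0 (fun i => ?_) i
  exact sub_eq_zero.mp (spatialDot_self_eq_zero h i)

theorem spatialDot_self (w : Mink n) :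
    algebraMap ℝ (Cl n) (spatialDot w w) =
      algebraMap ℝ (Cl n) (w 1 * w 1) + paraPart n w * conj (paraPart n w) := by
  rw [paraPart_apply, paravector_mul_conj, ← map_add, spatialDot, Fin.sum_univ_succ,
    Fin.sum_univ_succ]
  rfl

theorem conj_paraPart_mul (w : Mink n) :
    conj (paraPart n w) * paraPart n w = paraPart n w * conj (paraPart n w) := by
  obtain ⟨r, h1, h2, -⟩ := exists_normSq (paraPart_mem w)
  rw [h1, h2]

/-! ### The complement `κ̌` and the spin action -/

theorem check_add (κ μ : Fin 2 → Cl n) : check (κ + μ) = check κ + check μ := by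
  funext a
  fin_cases a <;> simp [check, add_comm]

theorem check_smul (r : ℝ) (κ : Fin 2 → Cl n) : check (r • κ) = r • check κ := by
  funext a
  fin_cases a <;> simp [check]

theorem check_check (κ : Fin 2 → Cl n) : check (check κ) = -κ := by
  funext a
  fin_cases a <;> simp [check]

theorem check_mul_right (κ : Fin 2 → Cl n) (x : Cl n) :
    check (fun a => κ a * x) = fun a => check κ a * gradeInv x := by
  funext a
  fin_cases a <;> simp [check]

/-- The action of `(T, Z; X)` by the traceless matrix `[Z, X; X̄, -Z]`. -/
noncomputable def spinAct (n : ℕ) : Mink n →ₗ[ℝ] Module.End ℝ (Fin 2 → Cl n) :=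
  LinearMap.mk₂ ℝ
    (fun w κ => ![w 1 • κ 0 + paraPart n w * κ 1, conj (paraPart n w) * κ 0 - w 1 • κ 1])
    (fun v w κ => by
      funext a
      fin_cases a <;> simp [add_smul, add_mul] <;> abel)
    (fun r w κ => by
      funext a
      fin_cases a <;> simp [mul_smul, smul_add, smul_sub])
    (fun w κ μ => by
      funext a
      fin_cases a <;> simp [mul_add] <;> abel)
    (fun r w κ => by
      funext a
      fin_cases a <;> simp [smul_add, smul_sub, smul_comm r])

theorem spinAct_apply (w : Mink n) (κ : Fin 2 → Cl n) : spinAct n w κ =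
    ![w 1 • κ 0 + paraPart n w * κ 1, conj (paraPart n w) * κ 0 - w 1 • κ 1] := rfl

theorem spinAct_mul_right (w : Mink n) (κ : Fin 2 → Cl n) (x : Cl n) :
    spinAct n w (fun a => κ a * x) = fun a => spinAct n w κ a * x := by
  funext a
  fin_cases a <;> simp [spinAct_apply, add_mul, sub_mul, mul_assoc]

/-- The Clifford relation for Euclidean `(n+2)`-space; the off-diagonal terms cancel because `Z` is
real, and `X X̄ = X̄ X`. -/
theorem spinAct_sq (w : Mink n) (κ : Fin 2 → Cl n) :
    spinAct n w (spinAct n w κ) = spatialDot w w • κ := by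
  funext a
  rw [Pi.smul_apply, Algebra.smul_def, spatialDot_self]
  fin_cases a
  · simp only [spinAct_apply, Fin.zero_eta, Matrix.cons_val_zero, Matrix.cons_val_one,
      Algebra.smul_def, map_mul, mul_add, mul_sub, add_mul, ← mul_assoc,
      Algebra.commutes (w 1) (paraPart n w)]
    abel
  · simp only [spinAct_apply, Fin.mk_one, Matrix.cons_val_zero, Matrix.cons_val_one,
      Algebra.smul_def, map_mul, mul_add, mul_sub, add_mul, ← mul_assoc,
      Algebra.commutes (w 1) (conj (paraPart n w)), conj_paraPart_mul]
    abel

theorem spinAct_add_swap (v w : Mink n) (κ : Fin 2 → Cl n) :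
    spinAct n v (spinAct n w κ) + spinAct n w (spinAct n v κ) =
      (2 * spatialDot v w) • κ := by
  have h := spinAct_sq (v + w) κ
  simp only [map_add, LinearMap.add_apply, spinAct_sq, spatialDot_add_left,
    spatialDot_add_right, spatialDot_comm w v] at h
  have h' : spinAct n v (spinAct n w κ) + spinAct n w (spinAct n v κ) =
      (spatialDot v v + spatialDot v w + (spatialDot v w + spatialDot w w)) • κ -
        spatialDot v v • κ - spatialDot w w • κ := by
    rw [← h]
    abel
  rw [h']
  module

/-- Together with `checkGen_sq` this makes each `checkGen j` a complex structure that anticommutes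
with all spatial vectors. -/
theorem check_spinAct (w : Mink n) (κ : Fin 2 → Cl n) :
    check (spinAct n w κ) = -spinAct n w (check κ) := by
  have h : gradeInv (conj (paraPart n w)) = paraPart n w := by
    rw [gradeInv_eq_conj (conj_mem_paravectors (paraPart_mem w)), conj_conj]
  funext a
  fin_cases a <;>
  simp [check, spinAct_apply, h, gradeInv_eq_conj (paraPart_mem w)] <;> abel

/-- The map `κ ↦ κ̌ i_j`. -/
noncomputable def checkGen (j : Fin n) : Module.End ℝ (Fin 2 → Cl n) where
  toFun κ := fun a => check κ a * gen n j
  map_add' κ μ := by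
    rw [check_add]
    exact funext fun a => add_mul _ _ _
  map_smul' r κ := by
    rw [check_smul]
    exact funext fun a => smul_mul_assoc r (check κ a) _

theorem checkGen_apply (j : Fin n) (κ : Fin 2 → Cl n) :
    checkGen j κ = fun a => check κ a * gen n j := rfl

theorem checkGen_mul_right (j : Fin n) (κ : Fin 2 → Cl n) (x : Cl n) :
    checkGen j (fun a => κ a * x) = fun a => check κ a * (gradeInv x * gen n j) := by
  rw [checkGen_apply, check_mul_right]
  exact funext fun a => mul_assoc _ _ _

theorem checkGen_checkGen (i j : Fin n) (κ : Fin 2 → Cl n) :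
    checkGen i (checkGen j κ) = fun a => κ a * (gen n j * gen n i) := by
  rw [checkGen_apply j, checkGen_mul_right, check_check]
  funext a
  simp

theorem checkGen_sq (j : Fin n) (κ : Fin 2 → Cl n) : checkGen j (checkGen j κ) = -κ := by
  rw [checkGen_checkGen]
  funext a
  simp

theorem checkGen_swap {i j : Fin n} (h : i ≠ j) (κ : Fin 2 → Cl n) :
    checkGen i (checkGen j κ) = -checkGen j (checkGen i κ) := by
  rw [checkGen_checkGen, checkGen_checkGen, gen_mul_gen_of_ne h]
  funext a
  simp

theorem checkGen_spinAct (j : Fin n) (w : Mink n) (κ : Fin 2 → Cl n) :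
    checkGen j (spinAct n w κ) = -spinAct n w (checkGen j κ) := by
  rw [checkGen_apply, checkGen_apply, check_spinAct, spinAct_mul_right]
  funext a
  simp

/-- The action on one nonzero pair is already faithful on spatial parts, as the difference would
square to its Euclidean square length. The `T` coordinate is invisible to `spinAct` and is matched
separately. -/
theorem eq_of_spinAct_eq {v w : Mink n} {κ : Fin 2 → Cl n} (hκ : κ ≠ 0)
    (h : spinAct n v κ = spinAct n w κ) (h0 : v 0 = w 0) : v = w := by
  refine eq_of_spatialDot_sub_self ?_ h0
  have h1 := spinAct_sq (v - w) κ
  have h2 : spinAct n (v - w) κ = 0 := by rw [map_sub, LinearMap.sub_apply, h, sub_self]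
  rw [h2, map_zero, eq_comm, smul_eq_zero] at h1
  exact h1.resolve_right hκ

/-- The spinor equations: `κ` is a common eigenvector attached to `p` and `v₁, …, vₙ`. -/
structure SpinorEquations (p : Mink n) (v : Fin n → Mink n) (κ : Fin 2 → Cl n) : Prop where
  base : spinAct n p κ = p 0 • κ
  flag : ∀ j, spinAct n (v j) κ = (2 * p 0) • checkGen j κ

namespace SpinorEquations

variable {p : Mink n} {v : Fin n → Mink n} {κ : Fin 2 → Cl n}

theorem smul (h : SpinorEquations p v κ) (r : ℝ) : SpinorEquations p v (r • κ) :=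
  ⟨by rw [map_smul, h.base, smul_comm], fun j => by
    rw [map_smul, map_smul, h.flag, smul_comm]⟩

/-- Here and in the next three results, squares and anticommutators of the operators, evaluated on
the nonzero `κ`, determine the Euclidean inner products of `p, v₁, …, vₙ`. -/
theorem spatialDot_base (h : SpinorEquations p v κ) (hκ : κ ≠ 0) :
    spatialDot p p = p 0 * p 0 := by
  have h1 := spinAct_sq p κ
  rw [h.base, map_smul, h.base, smul_smul] at h1
  exact (smul_left_injective ℝ hκ h1).symm

theorem spatialDot_base_flag (h : SpinorEquations p v κ) (hκ : κ ≠ 0) (j : Fin n) :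
    spatialDot p (v j) = 0 := by
  have h1 := spinAct_add_swap p (v j) κ
  have h2 : spinAct n p (checkGen j κ) = -(p 0 • checkGen j κ) := by
    rw [← neg_eq_iff_eq_neg, ← checkGen_spinAct, h.base, map_smul]
  rw [h.base, h.flag, map_smul, map_smul, h.flag, h2] at h1
  have h3 : (2 * spatialDot p (v j)) • κ = 0 := by
    rw [← h1]
    module
  simpa [hκ] using h3

theorem spatialDot_flag_self (h : SpinorEquations p v κ) (hκ : κ ≠ 0) (j : Fin n) :
    spatialDot (v j) (v j) = 2 * p 0 * (2 * p 0) := by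
  have h1 := spinAct_sq (v j) κ
  have h2 : spinAct n (v j) (checkGen j κ) = (2 * p 0) • κ := by
    rw [← neg_inj, ← checkGen_spinAct, h.flag, map_smul, checkGen_sq, smul_neg]
  rw [h.flag, map_smul, h2, smul_smul] at h1
  exact (smul_left_injective ℝ hκ h1).symm

theorem spatialDot_flag (h : SpinorEquations p v κ) (hκ : κ ≠ 0) {i j : Fin n} (hij : i ≠ j) :
    spatialDot (v i) (v j) = 0 := by
  have h1 := spinAct_add_swap (v i) (v j) κ
  have h2 : ∀ i j, spinAct n (v i) (checkGen j κ) = -((2 * p 0) • checkGen j (checkGen i κ)) := by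
    intro i j
    rw [← neg_eq_iff_eq_neg, ← checkGen_spinAct, h.flag, map_smul]
  rw [h.flag, h.flag, map_smul, map_smul, h2, h2, checkGen_swap hij] at h1
  have h3 : (2 * spatialDot (v i) (v j)) • κ = 0 := by
    rw [← h1]
    module
  simpa [hκ] using h3

end SpinorEquations

end Action
end LipschitzSpinors
namespace LipschitzSpinors

/-! ### The frame of a Lipschitz spinor -/

section SpinorFrame

variable {n : ℕ}

theorem mem_spinorSet_of_mul {ζ W : Cl n} (hζ : IsLipschitz ζ) (hW : W ∈ paravectors n) :
    ![ζ, W * ζ] ∈ spinorSet n := by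
  obtain ⟨r, -, hr, -⟩ := hζ.exists_normSq
  refine ⟨Or.inr hζ, mul_mem_lipschitzMonoid hW hζ, fun h => hζ.ne_zero (congrFun h 0), ?_⟩
  change ζ * conj (W * ζ) ∈ paravectors n
  rw [conj_mul, ← mul_assoc, hr, ← Algebra.smul_def]
  exact smul_mem_paravectors _ (conj_mem_paravectors hW)

theorem mem_spinorSet_of_zero {ζ : Cl n} (hζ : IsLipschitz ζ) : ![0, ζ] ∈ spinorSet n := by
  refine ⟨Or.inl rfl, Or.inr hζ, fun h => hζ.ne_zero (congrFun h 1), ?_⟩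
  change 0 * conj ζ ∈ paravectors n
  rw [zero_mul]
  exact zero_mem_paravectors

/-- If `ξ` is invertible then `η = W ξ`, where `W` is the conjugate of the paravector `ξ η̄` divided
by the square norm of `ξ`. Computations with spinors reduce to this form or to `(0, η)`. -/
theorem spinorSet_cases {κ : Fin 2 → Cl n} (hκ : κ ∈ spinorSet n) :
    (IsLipschitz (κ 0) ∧ ∃ W ∈ paravectors n, κ 1 = W * κ 0) ∨
      κ 0 = 0 ∧ IsLipschitz (κ 1) := by
  obtain ⟨h0, h1, hne, hp⟩ := hκ
  rcases h0 with h0 | h0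
  · refine Or.inr ⟨h0, h1.resolve_left fun h1 => hne (funext fun a => ?_)⟩
    fin_cases a
    exacts [h0, h1]
  · obtain ⟨r, hr, -, hr2⟩ := IsLipschitz.exists_normSq h0
    refine Or.inl ⟨h0, r⁻¹ • conj (κ 0 * conj (κ 1)),
      smul_mem_paravectors _ (conj_mem_paravectors hp), ?_⟩
    rw [conj_mul, conj_conj, smul_mul_assoc, mul_assoc, hr2, ← Algebra.commutes,
      ← Algebra.smul_def, smul_smul, inv_mul_cancel₀ hr.ne', one_smul]

theorem smul_mem_spinorSet {κ : Fin 2 → Cl n} (hκ : κ ∈ spinorSet n) {r : ℝ} (hr : r ≠ 0) :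
    r • κ ∈ spinorSet n := by
  have key : ∀ x ∈ lipschitzMonoid n, r • x ∈ lipschitzMonoid n := by
    rintro x (rfl | hx)
    · exact Or.inl (smul_zero r)
    · exact Or.inr (IsLipschitz.smul hx hr)
  obtain ⟨h0, h1, hne, hp⟩ := hκ
  refine ⟨key _ h0, key _ h1, smul_ne_zero hr hne, ?_⟩
  simp only [Pi.smul_apply, conj_smul, smul_mul_assoc, mul_smul_comm]
  exact smul_mem_paravectors _ (smul_mem_paravectors _ hp)

theorem exists_normSq_of_mem_spinorSet {κ : Fin 2 → Cl n} (hκ : κ ∈ spinorSet n) :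
    ∃ a b : ℝ, 0 < a + b ∧ κ 0 * conj (κ 0) = algebraMap ℝ (Cl n) a ∧
      κ 1 * conj (κ 1) = algebraMap ℝ (Cl n) b ∧
      conj (κ 0) * κ 0 + conj (κ 1) * κ 1 = algebraMap ℝ (Cl n) (a + b) := by
  have key : ∀ x ∈ lipschitzMonoid n, ∃ r : ℝ, 0 ≤ r ∧ (x ≠ 0 → 0 < r) ∧
      x * conj x = algebraMap ℝ (Cl n) r ∧ conj x * x = algebraMap ℝ (Cl n) r := by
    rintro x (rfl | hx)
    · exact ⟨0, le_rfl, fun h => absurd rfl h, by simp, by simp⟩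
    · obtain ⟨r, hr, h1, h2⟩ := IsLipschitz.exists_normSq hx
      exact ⟨r, hr.le, fun _ => hr, h1, h2⟩
  obtain ⟨a, ha, ha0, ha1, ha2⟩ := key _ hκ.1
  obtain ⟨b, hb, hb0, hb1, hb2⟩ := key _ hκ.2.1
  refine ⟨a, b, ?_, ha1, hb1, by rw [ha2, hb2, map_add]⟩
  rcases spinorSet_cases hκ with h | h
  · exact add_pos_of_pos_of_nonneg (ha0 h.1.ne_zero) hb
  · exact add_pos_of_nonneg_of_pos ha (hb0 h.2.ne_zero)

/-- The symmetry `η* ξ = ξ* η` is what makes `(κ̌ i_j)†κ` vanish. -/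
theorem reverse_mul_eq_of_mem_spinorSet {κ : Fin 2 → Cl n} (hκ : κ ∈ spinorSet n) :
    conj (gradeInv (κ 1)) * κ 0 = conj (gradeInv (κ 0)) * κ 1 := by
  rcases spinorSet_cases hκ with ⟨-, W, hW, h⟩ | ⟨h, -⟩
  · rw [h, gradeInv_mul, gradeInv_eq_conj hW, conj_mul, conj_conj, mul_assoc]
  · simp [h]

theorem mul_mul_reverse_mem {x y : Cl n} (hx : x ∈ lipschitzMonoid n)
    (hy : y ∈ paravectors n) : x * y * conj (gradeInv x) ∈ paravectors n := by
  rcases hx with rfl | hx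
  · simpa using zero_mem_paravectors
  · exact (IsLipschitz.mul_mul_mem hx hy).1

theorem gradeInv_mul_mul_conj_mem {x y : Cl n} (hx : x ∈ lipschitzMonoid n)
    (hy : y ∈ paravectors n) : gradeInv x * y * conj x ∈ paravectors n := by
  have h := mul_mul_reverse_mem hx (conj_mem_paravectors hy)
  have h1 : gradeInv (x * conj y * conj (gradeInv x)) = gradeInv x * y * conj x := by
    rw [gradeInv_mul, gradeInv_mul, gradeInv_eq_conj (conj_mem_paravectors hy), conj_conj,
      conj_gradeInv, gradeInv_gradeInv]
  rw [← h1, gradeInv_eq_conj h]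
  exact conj_mem_paravectors h

/-- This is the upper diagonal entry of `D_κ φ₁(κ̌ i_j)`. With `η = W ξ` it equals `xy` plus its
conjugate, for the paravectors `x = W̄` and `y = ξ' i_j ξ̄`, hence is real. -/
theorem exists_diagonal_of_mem_spinorSet {κ : Fin 2 → Cl n} (hκ : κ ∈ spinorSet n)
    (j : Fin n) : ∃ r : ℝ, gradeInv (κ 1) * gen n j * conj (κ 0) -
      κ 0 * gen n j * conj (gradeInv (κ 1)) = algebraMap ℝ (Cl n) r := by
  have h1 : ∃ x ∈ paravectors n, ∃ y ∈ paravectors n,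
      gradeInv (κ 1) * gen n j * conj (κ 0) = x * y := by
    rcases spinorSet_cases hκ with ⟨-, W, hW, h⟩ | ⟨h, -⟩
    · refine ⟨conj W, conj_mem_paravectors hW, _,
        gradeInv_mul_mul_conj_mem hκ.1 (gen_mem_paravectors j), ?_⟩
      rw [h, gradeInv_mul, gradeInv_eq_conj hW]
      simp only [mul_assoc]
    · exact ⟨0, zero_mem_paravectors, 0, zero_mem_paravectors, by simp [h]⟩
  obtain ⟨x, hx, y, hy, hxy⟩ := h1
  obtain ⟨r, hr⟩ := exists_mul_add_conj hx hy
  refine ⟨r, ?_⟩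
  rw [← hr, ← hxy]
  simp only [conj_mul, conj_conj, conj_gen, mul_neg, neg_mul, mul_assoc, sub_eq_add_neg]

/-- A matrix acting on a pair. -/
noncomputable def matAct (h : Fin 2 → Fin 2 → Cl n) (κ : Fin 2 → Cl n) : Fin 2 → Cl n :=
  fun a => h a 0 * κ 0 + h a 1 * κ 1

theorem hermMatrix_apply (p : Mink n) :
    hermMatrix p 0 0 = (1 / 2 : ℝ) • algebraMap ℝ (Cl n) (p 0 + p 1) ∧
      hermMatrix p 0 1 = (1 / 2 : ℝ) • paraPart n p ∧
      hermMatrix p 1 0 = (1 / 2 : ℝ) • conj (paraPart n p) ∧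
      hermMatrix p 1 1 = (1 / 2 : ℝ) • algebraMap ℝ (Cl n) (p 0 - p 1) :=
  ⟨rfl, rfl, rfl, rfl⟩

/-- Splits the Hermitian matrix into its trace part and its traceless part. -/
theorem matAct_hermMatrix (p : Mink n) (κ : Fin 2 → Cl n) :
    matAct (hermMatrix p) κ = (1 / 2 : ℝ) • (p 0 • κ + spinAct n p κ) := by
  obtain ⟨h1, h2, h3, h4⟩ := hermMatrix_apply p
  funext a
  fin_cases a
  · simp only [matAct, Fin.zero_eta, h1, h2, spinAct_apply, Pi.smul_apply, Pi.add_apply,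
      Matrix.cons_val_zero, smul_mul_assoc, ← Algebra.smul_def, add_smul, smul_add, add_assoc]
  · simp only [matAct, Fin.mk_one, h3, h4, spinAct_apply, Pi.smul_apply, Pi.add_apply,
      Matrix.cons_val_zero, Matrix.cons_val_one, smul_mul_assoc, ← Algebra.smul_def, sub_smul]
    rw [← smul_add]
    congr 1
    abel

/-- `κ† μ`. -/
noncomputable def dagger (κ μ : Fin 2 → Cl n) : Cl n := conj (κ 0) * μ 0 + conj (κ 1) * μ 1

theorem matAct_outer (κ μ : Fin 2 → Cl n) :
    matAct (outer κ) μ = fun a => κ a * dagger κ μ := by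
  funext a
  simp only [matAct, outer, dagger, mul_add, mul_assoc]

/-- The derivative of `outer` at `κ` in the direction `μ`. -/
noncomputable def outerDeriv (κ μ : Fin 2 → Cl n) : Fin 2 → Fin 2 → Cl n :=
  fun a b => μ a * conj (κ b) + κ a * conj (μ b)

theorem matAct_outerDeriv (κ μ ν : Fin 2 → Cl n) :
    matAct (outerDeriv κ μ) ν = fun a => μ a * dagger κ ν + κ a * dagger μ ν := by
  funext a
  simp only [matAct, outerDeriv, dagger]
  noncomm_ring

theorem exists_hermMatrix (h : Fin 2 → Fin 2 → Cl n) (s t : ℝ)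
    (h00 : h 0 0 = algebraMap ℝ (Cl n) s) (h11 : h 1 1 = algebraMap ℝ (Cl n) t)
    (h01 : h 0 1 ∈ paravectors n) (h10 : h 1 0 = conj (h 0 1)) :
    ∃ p : Mink n, hermMatrix p = h ∧ p 0 = s + t := by
  obtain ⟨x₀, x, hx⟩ := h01
  let p : Mink n := Fin.cons (s + t) (Fin.cons (s - t) (Fin.cons (2 * x₀) ((2 : ℝ) • x)))
  have hp : paraPart n p = (2 : ℝ) • h 0 1 := by
    rw [hx, smul_paravector]
    rfl
  have hp0 : p 0 = s + t := rfl
  have hp1 : p 1 = s - t := rfl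
  obtain ⟨h1, h2, h3, h4⟩ := hermMatrix_apply p
  refine ⟨p, ?_, rfl⟩
  funext a b
  fin_cases a <;> fin_cases b <;>
  simp only [Fin.zero_eta, Fin.mk_one, h1, h2, h3, h4, hp, hp0, hp1, h00, h11, h10, conj_smul,
    smul_smul]
  · rw [Algebra.smul_def, ← map_mul]
    congr 1
    ring
  · norm_num
  · norm_num
  · rw [Algebra.smul_def, ← map_mul]
    congr 1
    ring

/-- The spinor equations come from applying the matrices to `κ` itself: `κκ†κ = Tκ`, while in the
derivative the term `κ(κ̌ i_j)†κ` drops out. -/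
theorem exists_spinorFrame {κ : Fin 2 → Cl n} (hκ : κ ∈ spinorSet n) :
    ∃ (p : Mink n) (v : Fin n → Mink n), hermMatrix p = outer κ ∧
      (∀ j, hermMatrix (v j) = outerDeriv κ (checkGen j κ)) ∧ SpinorEquations p v κ ∧
      0 < p 0 ∧ (∀ j, v j 0 = 0) ∧ dagger κ κ = algebraMap ℝ (Cl n) (p 0) := by
  obtain ⟨a, b, hab, ha, hb, hN⟩ := exists_normSq_of_mem_spinorSet hκ
  obtain ⟨p, hp, hp0⟩ := exists_hermMatrix (outer κ) a b ha hb hκ.2.2.2 (by simp [outer])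
  have hN' : dagger κ κ = algebraMap ℝ (Cl n) (p 0) := by rw [hp0]; exact hN
  have hv : ∀ j, ∃ w : Mink n, hermMatrix w = outerDeriv κ (checkGen j κ) ∧ w 0 = 0 := by
    intro j
    obtain ⟨r, hr⟩ := exists_diagonal_of_mem_spinorSet hκ j
    -- The lower diagonal entry is minus the grade involution of the upper one, so the trace
    -- vanishes and `w` has `T = 0`.
    obtain ⟨w, hw, hw0⟩ := exists_hermMatrix (outerDeriv κ (checkGen j κ)) r (-r)
      (by
        rw [← hr]
        simp [outerDeriv, checkGen_apply, check, mul_assoc, sub_eq_add_neg])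
      (by
        rw [map_neg, ← gradeInv_algebraMap, ← hr]
        simp [outerDeriv, checkGen_apply, check, mul_assoc, conj_gradeInv])
      (by
        have h1 := gradeInv_mul_mul_conj_mem hκ.2.1 (gen_mem_paravectors j)
        have h2 := mul_mul_reverse_mem hκ.1 (gen_mem_paravectors j)
        have h3 := add_mem_paravectors h1 h2
        simpa [outerDeriv, checkGen_apply, check, mul_assoc] using h3)
      (by simp [outerDeriv, checkGen_apply, check, mul_assoc, add_comm])
    exact ⟨w, hw, by rw [hw0, add_neg_cancel]⟩
  choose v hv hv0 using hv
  refine ⟨p, v, hp, hv, ⟨?_, fun j => ?_⟩, hp0 ▸ hab, hv0, hN'⟩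
  · have h1 := matAct_hermMatrix p κ
    have h2 : matAct (outer κ) κ = p 0 • κ := by
      rw [matAct_outer, hN']
      funext a
      rw [Pi.smul_apply, Algebra.smul_def, Algebra.commutes]
    rw [hp, h2] at h1
    have h3 : spinAct n p κ = (2 : ℝ) • ((1 / 2 : ℝ) • (p 0 • κ + spinAct n p κ)) - p 0 • κ := by
      module
    rw [h3, ← h1]
    module
  · have h1 := matAct_hermMatrix (v j) κ
    have h2 : dagger (checkGen j κ) κ = 0 := by
      have h3 := reverse_mul_eq_of_mem_spinorSet hκ
      simp only [dagger, checkGen_apply, check, Matrix.cons_val_zero, Matrix.cons_val_one,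
        conj_mul, conj_gen, conj_neg, neg_mul, neg_neg, mul_assoc, h3]
      abel
    have h4 : matAct (outerDeriv κ (checkGen j κ)) κ = p 0 • checkGen j κ := by
      rw [matAct_outerDeriv, hN', h2]
      funext a
      rw [Pi.smul_apply, Algebra.smul_def, Algebra.commutes, mul_zero, add_zero]
    rw [hv, h4, hv0, zero_smul, zero_add] at h1
    rw [mul_smul, h1, smul_smul]
    norm_num

/-- Solutions of the equations of a spinor are its real multiples. -/
theorem eq_smul_of_spinorEquations {κ μ : Fin 2 → Cl n} {p : Mink n} {v : Fin n → Mink n}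
    (hp : hermMatrix p = outer κ) (hN : dagger κ κ = algebraMap ℝ (Cl n) (p 0)) (h0 : 0 < p 0) (h : SpinorEquations p v κ) (hμ : SpinorEquations p v μ) :
    ∃ c : ℝ, μ = c • κ := by
  have h1 := matAct_hermMatrix p μ
  rw [hp, matAct_outer, hμ.base, ← two_smul ℝ (p 0 • μ), smul_smul] at h1
  norm_num at h1
  -- Since `κκ†` acts on `μ` as `T`, `μ = κ (κ†μ) / T`.
  let y : Cl n := (p 0)⁻¹ • dagger κ μ
  have hy : μ = fun a => κ a * y := by
    funext a
    have h2 := congrFun h1 a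
    simp only [y, mul_smul_comm, h2, Pi.smul_apply, smul_smul, inv_mul_cancel₀ h0.ne', one_smul]
  -- Comparing the flag equations of `κ` and `κ y` gives `κ̌ i_j y = κ̌ y' i_j`; multiplying by
  -- `κ̌†` cancels `κ̌`, because `κ̌†κ̌ = T`.
  have hyc : ∀ j, y * gen n j = gen n j * gradeInv y := by
    intro j
    have h2 := hμ.flag j
    rw [hy, spinAct_mul_right, h.flag, checkGen_mul_right] at h2
    have h3 : ∀ a, check κ a * (gen n j * y) = check κ a * (gradeInv y * gen n j) := by
      intro a
      have h4 := congrFun h2 a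
      simp only [Pi.smul_apply, smul_mul_assoc, checkGen_apply, mul_assoc] at h4
      exact smul_right_injective _ (by positivity : (2 * p 0) ≠ 0) h4
    have h5 : dagger (check κ) (check κ) = algebraMap ℝ (Cl n) (p 0) := by
      rw [← gradeInv_algebraMap, ← hN]
      simp [dagger, check, conj_gradeInv, add_comm]
    have h6 : p 0 • (gen n j * y) = p 0 • (gradeInv y * gen n j) := by
      rw [Algebra.smul_def, Algebra.smul_def, ← h5, dagger, add_mul, add_mul, mul_assoc,
        mul_assoc, mul_assoc, mul_assoc, h3, h3]
    have h7 := congrArg gradeInv (smul_right_injective _ h0.ne' h6)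
    simpa [eq_comm] using h7
  obtain ⟨c, hc⟩ := eq_algebraMap_of_gen_mul y hyc
  refine ⟨c, ?_⟩
  rw [hy, hc]
  funext a
  rw [Pi.smul_apply, Algebra.smul_def, Algebra.commutes]

end SpinorFrame
end LipschitzSpinors
namespace LipschitzSpinors

/-! ### Normalised flag vectors -/

section Flags

variable {n : ℕ}

/-- The spatial representative of `v` modulo `p`. -/
noncomputable def spatialRep (p v : Mink n) : Mink n := v - (v 0 / p 0) • p

/-- The spatial representative of `v` modulo `p`, scaled to length `2 T`. -/
noncomputable def flagVec (p v : Mink n) : Mink n :=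
  (2 * p 0 / Real.sqrt (spatialDot (spatialRep p v) (spatialRep p v))) • spatialRep p v

theorem spatialRep_smul_add {p : Mink n} (h0 : p 0 ≠ 0) (r c : ℝ) (w : Mink n) :
    spatialRep p (r • w + c • p) = r • spatialRep p w := by
  funext i
  simp only [spatialRep, Pi.sub_apply, Pi.add_apply, Pi.smul_apply, smul_eq_mul]
  field_simp
  ring

theorem spatialRep_apply_zero {p : Mink n} (h0 : p 0 ≠ 0) (v : Mink n) :
    spatialRep p v 0 = 0 := by
  simp [spatialRep, h0]

theorem flagVec_apply_zero {p : Mink n} (h0 : p 0 ≠ 0) (v : Mink n) : flagVec p v 0 = 0 := by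
  rw [flagVec, Pi.smul_apply, spatialRep_apply_zero h0, smul_zero]

theorem flagVec_smul_add {p : Mink n} (h0 : p 0 ≠ 0) {r : ℝ} (hr : 0 < r) (c : ℝ)
    (w : Mink n) : flagVec p (r • w + c • p) = flagVec p w := by
  rw [flagVec, flagVec, spatialRep_smul_add h0, spatialDot_smul_left, spatialDot_smul_right,
    ← mul_assoc, Real.sqrt_mul (mul_self_nonneg r), Real.sqrt_mul_self hr.le, smul_smul]
  congr 1
  rw [div_mul_eq_mul_div, mul_comm r (Real.sqrt _), mul_div_mul_right _ _ hr.ne']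

theorem spatialRep_ne_zero {p v : Mink n}
    (h : (Submodule.Quotient.mk v : Mink n ⧸ Submodule.span ℝ {p}) ≠ 0) :
    spatialRep p v ≠ 0 := by
  intro h1
  refine h ((Submodule.Quotient.mk_eq_zero _).mpr ?_)
  rw [sub_eq_zero.mp h1]
  exact Submodule.smul_mem _ _ (Submodule.mem_span_singleton_self p)

theorem spatialDot_spatialRep_pos {p v : Mink n} (h0 : p 0 ≠ 0)
    (h : (Submodule.Quotient.mk v : Mink n ⧸ Submodule.span ℝ {p}) ≠ 0) :
    0 < spatialDot (spatialRep p v) (spatialRep p v) := by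
  refine lt_of_le_of_ne (spatialDot_self_nonneg _) fun h1 => spatialRep_ne_zero h ?_
  refine eq_of_spatialDot_sub_self ?_ (spatialRep_apply_zero h0 v)
  rw [sub_zero, ← h1]

theorem sameFlag_smul_add (p w : Mink n) {r : ℝ} (hr : 0 < r) (c : ℝ) :
    SameFlag p (r • w + c • p) w := by
  refine ⟨le_antisymm (Submodule.span_le.mpr ?_) (Submodule.span_le.mpr ?_), ?_⟩
  · rintro x (rfl | rfl)
    · exact Submodule.subset_span (Or.inl rfl)
    · exact add_mem (Submodule.smul_mem _ _ (Submodule.subset_span (Or.inr rfl)))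
        (Submodule.smul_mem _ _ (Submodule.subset_span (Or.inl rfl)))
  · rintro x (rfl | rfl)
    · exact Submodule.subset_span (Or.inl rfl)
    · have h : x = r⁻¹ • ((r • x + c • p) - c • p) := by
        rw [add_sub_cancel_right, smul_smul, inv_mul_cancel₀ hr.ne', one_smul]
      have h' : r⁻¹ • ((r • x + c • p) - c • p) ∈ Submodule.span ℝ {p, r • x + c • p} :=
        Submodule.smul_mem _ _ (sub_mem (Submodule.subset_span (Or.inr rfl))
          (Submodule.smul_mem _ _ (Submodule.subset_span (Or.inl rfl))))
      rw [← h] at h'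
      exact h'
  · have h : (Submodule.Quotient.mk (r • w + c • p) : Mink n ⧸ Submodule.span ℝ {p}) =
        r • Submodule.Quotient.mk w := by
      rw [← Submodule.Quotient.mk_smul, Submodule.Quotient.eq, add_sub_cancel_left]
      exact Submodule.smul_mem _ _ (Submodule.mem_span_singleton_self p)
    rw [h]
    exact SameRay.sameRay_pos_smul_left _ hr

/-- Flags with the same base-point differ by `v ↦ r v + c p` with `r > 0`; removing the `T`
coordinate fixes `c` and fixing the length fixes `r`. -/
theorem sameFlag_iff_flagVec_eq {p v w : Mink n} (h0 : 0 < p 0)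
    (hv : (Submodule.Quotient.mk v : Mink n ⧸ Submodule.span ℝ {p}) ≠ 0)
    (hw : (Submodule.Quotient.mk w : Mink n ⧸ Submodule.span ℝ {p}) ≠ 0) :
    SameFlag p v w ↔ flagVec p v = flagVec p w := by
  constructor
  · rintro ⟨-, h⟩
    obtain ⟨r, s, hr, hs, hrs⟩ := h.exists_pos hv hw
    rw [← Submodule.Quotient.mk_smul, ← Submodule.Quotient.mk_smul, Submodule.Quotient.eq,
      Submodule.mem_span_singleton] at hrs
    obtain ⟨c, hc⟩ := hrs
    have h1 : v = (r⁻¹ * s) • w + (r⁻¹ * c) • p := by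
      rw [mul_smul, mul_smul, hc, ← smul_add, add_sub_cancel, smul_smul,
        inv_mul_cancel₀ hr.ne', one_smul]
    rw [h1, flagVec_smul_add h0.ne' (mul_pos (inv_pos.mpr hr) hs)]
  · intro h
    set a := 2 * p 0 / Real.sqrt (spatialDot (spatialRep p v) (spatialRep p v)) with ha
    set b := 2 * p 0 / Real.sqrt (spatialDot (spatialRep p w) (spatialRep p w)) with hb
    have ha0 : 0 < a :=
      div_pos (by linarith) (Real.sqrt_pos.mpr (spatialDot_spatialRep_pos h0.ne' hv))
    have hb0 : 0 < b :=
      div_pos (by linarith) (Real.sqrt_pos.mpr (spatialDot_spatialRep_pos h0.ne' hw))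
    have h1 : a • spatialRep p v = b • spatialRep p w := h
    have h2 : v = (a⁻¹ * b) • w + (v 0 / p 0 - a⁻¹ * b * (w 0 / p 0)) • p := by
      have h3 : spatialRep p v = (a⁻¹ * b) • spatialRep p w := by
        rw [mul_smul, ← h1, smul_smul, inv_mul_cancel₀ ha0.ne', one_smul]
      have h4 : v = spatialRep p v + (v 0 / p 0) • p := (sub_add_cancel _ _).symm
      rw [h3] at h4
      nth_rewrite 1 [h4]
      rw [spatialRep]
      module
    rw [h2]
    exact sameFlag_smul_add p w (mul_pos (inv_pos.mpr ha0) hb0) _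

theorem flagVec_eq_self {p v : Mink n} (h0 : 0 < p 0) (hv : v 0 = 0)
    (h : spatialDot v v = 2 * p 0 * (2 * p 0)) : flagVec p v = v := by
  have h1 : spatialRep p v = v := by simp [spatialRep, hv]
  rw [flagVec, h1, h, Real.sqrt_mul_self (by linarith), div_self (by linarith), one_smul]

/-- On `p^⊥` the Minkowski form is unchanged by adding multiples of `p`, and on vectors with `T = 0`
it is minus the Euclidean product. -/
theorem spatialDot_spatialRep {p v w : Mink n} (h0 : p 0 ≠ 0)
    (hp : mink p p = 0) (hv : mink p v = 0) (hw : mink p w = 0) :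
    spatialDot (spatialRep p v) (spatialRep p w) = -mink v w := by
  rw [mink_eq, sub_eq_zero, eq_comm] at hp hv hw
  have h1 : ∀ u : Mink n, spatialRep p u = u + (-(u 0 / p 0)) • p := fun u => by
    rw [spatialRep, neg_smul, sub_eq_add_neg]
  rw [h1, h1, spatialDot_add_left, spatialDot_add_right, spatialDot_add_right,
    spatialDot_smul_left, spatialDot_smul_left, spatialDot_smul_right, spatialDot_smul_right,
    spatialDot_comm v p, hp, hv, hw, mink_eq]
  field_simp
  ring

theorem spatialDot_base_spatialRep {p v : Mink n}
    (hp : mink p p = 0) (hv : mink p v = 0) : spatialDot p (spatialRep p v) = 0 := by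
  rw [mink_eq, sub_eq_zero, eq_comm] at hp hv
  have h1 : spatialRep p v = v + (-(v 0 / p 0)) • p := by
    rw [spatialRep, neg_smul, sub_eq_add_neg]
  rw [h1, spatialDot_add_right, spatialDot_smul_right, hp, hv]
  field_simp
  ring

/-- The normalised flag vectors of a frame are orthogonal to the base point and to each other,
and have length `2 T`. -/
theorem flagVec_orthogonal (f : frameSet n) :
    (∀ j, spatialDot f.1.1 (flagVec f.1.1 (f.1.2 j)) = 0) ∧
      (∀ j, spatialDot (flagVec f.1.1 (f.1.2 j)) (flagVec f.1.1 (f.1.2 j)) =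
        2 * f.1.1 0 * (2 * f.1.1 0)) ∧
      ∀ i j, i ≠ j → spatialDot (flagVec f.1.1 (f.1.2 i)) (flagVec f.1.1 (f.1.2 j)) = 0 := by
  obtain ⟨⟨hp, h0⟩, ht, ho, -, -⟩ := f.2
  refine ⟨fun j => ?_, fun j => ?_, fun i j hij => ?_⟩
  · rw [flagVec, spatialDot_smul_right, spatialDot_base_spatialRep hp (ht j), mul_zero]
  · have hs := spatialDot_spatialRep_pos h0.ne' (mk_ne_zero_of_frame f j)
    have h1 := Real.sqrt_pos.mpr hs
    have h2 := Real.mul_self_sqrt hs.le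
    rw [flagVec, spatialDot_smul_left, spatialDot_smul_right]
    nth_rewrite 3 [← h2]
    field_simp
  · rw [flagVec, flagVec, spatialDot_smul_left, spatialDot_smul_right,
      spatialDot_spatialRep h0.ne' hp (ht i) (ht j), ho i j hij, neg_zero, mul_zero, mul_zero]

/-! ### Spinors define frames -/

theorem linearIndependent_of_spatialDot {m : ℕ} (b : Fin m → Mink n)
    (h : ∀ i j, i ≠ j → spatialDot (b i) (b j) = 0) (h' : ∀ i, spatialDot (b i) (b i) ≠ 0) :
    LinearIndependent ℝ b := by
  exact LinearMap.linearIndependent_of_isOrthoᵢ (B := spatialForm n) (fun i j hij => h i j hij)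
    fun i => h' i

theorem spatialDot_cons {m : ℕ} {a : Mink n} {b : Fin m → Mink n}
    (ha : ∀ j, spatialDot a (b j) = 0)
    (hb : ∀ i j, i ≠ j → spatialDot (b i) (b j) = 0) (i j : Fin (m + 1)) (hij : i ≠ j) :
    spatialDot ((Fin.cons a b : Fin (m + 1) → Mink n) i)
      ((Fin.cons a b : Fin (m + 1) → Mink n) j) = 0 := by
  induction i using Fin.cases with
  | zero =>
    induction j using Fin.cases with
    | zero => exact absurd rfl hij
    | succ j => simpa using ha j
  | succ i =>
    induction j using Fin.cases with
    | zero => simpa [spatialDot_comm] using ha i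
    | succ j => simpa using hb i j fun h => hij (by rw [h])

/-- Orientation costs nothing: the `n` flag vectors live in an `(n+1)`-dimensional quotient, so a
completing vector exists and its sign can be chosen to make the determinant positive. -/
theorem mem_frameSet_of_spatialDot {p : Mink n} {v : Fin n → Mink n} (h0 : 0 < p 0)
    (hv0 : ∀ j, v j 0 = 0) (hp : spatialDot p p = p 0 * p 0)
    (hpv : ∀ j, spatialDot p (v j) = 0) (hv : ∀ j, spatialDot (v j) (v j) ≠ 0)
    (ho : ∀ i j, i ≠ j → spatialDot (v i) (v j) = 0) : (p, v) ∈ frameSet n := by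
  have hp' : spatialDot p p ≠ 0 := by
    rw [hp]
    positivity
  refine ⟨⟨by rw [mink_eq, hp, sub_self], h0⟩, fun j => ?_, fun i j hij => ?_, ?_, ?_⟩
  · change mink p (v j) = 0
    rw [mink_eq, hv0, hpv, mul_zero, sub_self]
  · change mink (v i) (v j) = 0
    rw [mink_eq, hv0, ho i j hij, zero_mul, sub_self]
  · refine linearIndependent_of_spatialDot _ (spatialDot_cons hpv ho) fun i => ?_
    induction i using Fin.cases with
    | zero => simpa using hp'
    | succ j => simpa using hv j
  -- `n + 2` linear conditions on an `(n+3)`-dimensional space leave a nonzero `w` with `T = 0`,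
  -- orthogonal to `p` and to every `v_j`.
  let L : Mink n →ₗ[ℝ] (Fin (n + 2) → ℝ) := LinearMap.pi
    (Fin.cons (LinearMap.proj 0) (Fin.cons (spatialForm n p) fun j => spatialForm n (v j)) :
      Fin (n + 2) → (Mink n →ₗ[ℝ] ℝ))
  obtain ⟨w, hw, hw0⟩ := Submodule.exists_mem_ne_zero_of_ne_bot
    (LinearMap.ker_ne_bot_of_finrank_lt (f := L) (by simp))
  have hL : ∀ i, L w i = 0 := fun i => congrFun hw i
  have hw1 : w 0 = 0 := hL 0
  have hw2 : spatialDot p w = 0 := hL 1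
  have hw3 : ∀ j : Fin n, spatialDot (v j) w = 0 := fun j => hL j.succ.succ
  have hww : spatialDot w w ≠ 0 := fun h =>
    hw0 (eq_of_spatialDot_sub_self (by rwa [sub_zero]) hw1)
  let q : Mink n := Function.update p 0 0
  have hq : ∀ u : Mink n, spatialDot q u = spatialDot p u := fun u => by
    simp [spatialDot, q, Function.update_of_ne]
  have hq0 : q 0 = 0 := by simp [q]
  let R : Mink n → Fin (n + 3) → Mink n := fun w =>
    Fin.cons (Pi.single 0 1) (Fin.cons q (Fin.cons w v : Fin (n + 1) → Mink n) :
      Fin (n + 2) → Mink n)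
  have hR : LinearIndependent ℝ (R w) := by
    refine linearIndependent_finCons.mpr ⟨linearIndependent_of_spatialDot _
      (spatialDot_cons (fun i => ?_) (spatialDot_cons (fun j => ?_) ho)) fun i => ?_, ?_⟩
    · rw [hq]
      induction i using Fin.cases with
      | zero => simpa using hw2
      | succ j => simpa using hpv j
    · rw [spatialDot_comm, hw3]
    · induction i using Fin.cases with
      | zero =>
        rw [Fin.cons_zero, hq, spatialDot_comm, hq]
        exact hp'
      | succ i =>
        induction i using Fin.cases with
        | zero => simpa using hww
        | succ j => simpa using hv j
    · intro hmem
      have hle : Submodule.span ℝ (Set.range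
          (Fin.cons q (Fin.cons w v : Fin (n + 1) → Mink n) : Fin (n + 2) → Mink n)) ≤
          LinearMap.ker (LinearMap.proj 0 : Mink n →ₗ[ℝ] ℝ) := by
        rw [Submodule.span_le]
        rintro _ ⟨i, rfl⟩
        induction i using Fin.cases with
        | zero => exact hq0
        | succ i =>
          induction i using Fin.cases with
          | zero => exact hw1
          | succ j => exact hv0 j
      have h1 := hle hmem
      simp at h1
  have hdet : Matrix.det (Matrix.of (R w)) ≠ 0 := by
    have h1 := Matrix.linearIndependent_rows_iff_isUnit.mp
      (show LinearIndependent ℝ (Matrix.of (R w)).row from hR)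
    exact ((Matrix.isUnit_iff_isUnit_det _).mp h1).ne_zero
  have hneg : Matrix.det (Matrix.of (R (-w))) = -Matrix.det (Matrix.of (R w)) := by
    have h1 : Matrix.of (R (-w)) = (Matrix.of (R w)).updateRow 2 ((-1 : ℝ) • w) := by
      ext i j
      induction i using Fin.cases with
      | zero => rfl
      | succ i =>
        induction i using Fin.cases with
        | zero => rfl
        | succ i =>
          induction i using Fin.cases with
          | zero =>
            change (-w) j = _
            rw [show (Fin.succ (Fin.succ 0) : Fin (n + 3)) = 2 from rfl, Matrix.updateRow_self]
            simp
          | succ k =>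
            rw [Matrix.updateRow_ne (by
              intro h
              rw [show (2 : Fin (n + 3)) = Fin.succ (Fin.succ 0) from rfl, Fin.succ_inj,
                Fin.succ_inj] at h
              exact Fin.succ_ne_zero k h)]
            rfl
    have h2 : (Matrix.of (R w)).updateRow 2 w = Matrix.of (R w) :=
      Matrix.updateRow_eq_self _ _
    rw [h1, Matrix.det_updateRow_smul, h2, neg_one_mul]
  have key : ∀ u : Mink n, u = w ∨ u = -w → 0 < Matrix.det (Matrix.of (R u)) →
      ∃ v₀ ∈ tangentCone p, (∀ j, mink v₀ (v j) = 0) ∧ OutwardOriented p (Fin.cons v₀ v) := by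
    intro u hu hdet
    have hu0 : u 0 = 0 ∧ spatialDot p u = 0 ∧ ∀ j, spatialDot (v j) u = 0 := by
      rcases hu with rfl | rfl
      · exact ⟨hw1, hw2, hw3⟩
      · have h1 : ∀ x : Mink n, spatialDot x (-w) = -spatialDot x w := fun x => by
          simpa using spatialDot_smul_right (-1) x w
        simp [h1, hw1, hw2, hw3]
    refine ⟨u, ?_, fun j => ?_, hdet⟩
    · change mink p u = 0
      rw [mink_eq, hu0.1, hu0.2.1, mul_zero, sub_self]
    · rw [mink_eq, hu0.1, spatialDot_comm, hu0.2.2, zero_mul, sub_self]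
  rcases lt_or_gt_of_ne hdet with h | h
  · exact key (-w) (Or.inr rfl) (by rw [hneg]; linarith)
  · exact key w (Or.inl rfl) h

theorem exists_spinorFrame_mem (κ : spinorSet n) : ∃ f : frameSet n,
    hermMatrix f.1.1 = outer κ.1 ∧
      (∀ j, hermMatrix (f.1.2 j) = outerDeriv κ.1 (checkGen j κ.1)) ∧
      SpinorEquations f.1.1 f.1.2 κ.1 ∧ 0 < f.1.1 0 ∧ (∀ j, f.1.2 j 0 = 0) ∧
      dagger κ.1 κ.1 = algebraMap ℝ (Cl n) (f.1.1 0) := by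
  obtain ⟨p, v, h1, h2, h3, h4, h5, h6⟩ := exists_spinorFrame κ.2
  have hκ : κ.1 ≠ 0 := κ.2.2.2.1
  refine ⟨⟨(p, v), mem_frameSet_of_spatialDot h4 h5 (h3.spatialDot_base hκ)
    (h3.spatialDot_base_flag hκ) (fun j => ?_) fun i j => h3.spatialDot_flag hκ⟩,
    h1, h2, h3, h4, h5, h6⟩
  rw [h3.spatialDot_flag_self hκ]
  positivity

/-- The frame `(φ₁(κ); D φ₁(κ̌ i₁), …, D φ₁(κ̌ iₙ))` of a spinor. -/
noncomputable def spinorFrame (κ : spinorSet n) : frameSet n := (exists_spinorFrame_mem κ).choose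

theorem spinorFrame_spec (κ : spinorSet n) :
    hermMatrix (spinorFrame κ).1.1 = outer κ.1 ∧
      (∀ j, hermMatrix ((spinorFrame κ).1.2 j) = outerDeriv κ.1 (checkGen j κ.1)) ∧
      SpinorEquations (spinorFrame κ).1.1 (spinorFrame κ).1.2 κ.1 ∧
      0 < (spinorFrame κ).1.1 0 ∧ (∀ j, (spinorFrame κ).1.2 j 0 = 0) ∧
      dagger κ.1 κ.1 = algebraMap ℝ (Cl n) ((spinorFrame κ).1.1 0) :=
  (exists_spinorFrame_mem κ).choose_spec

/-- The map `Φ₁`. -/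
noncomputable def multiflagMap (κ : spinorSet n) : Multiflag n := ⟦spinorFrame κ⟧

/-! ### The fibres of `Φ₁` -/

theorem mk_eq_mk_iff (f g : frameSet n) : (⟦f⟧ : Multiflag n) = ⟦g⟧ ↔
    f.1.1 = g.1.1 ∧ ∀ j, flagVec f.1.1 (f.1.2 j) = flagVec g.1.1 (g.1.2 j) := by
  rw [Quotient.eq]
  refine and_congr_right fun hp => forall_congr' fun j => ?_
  have h := mk_ne_zero_of_frame g j
  rw [← hp] at h ⊢
  exact sameFlag_iff_flagVec_eq f.2.1.2 (mk_ne_zero_of_frame f j) h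

theorem flagVec_spinorFrame (κ : spinorSet n) (j : Fin n) :
    flagVec (spinorFrame κ).1.1 ((spinorFrame κ).1.2 j) = (spinorFrame κ).1.2 j := by
  obtain ⟨-, -, h3, h4, h5, -⟩ := spinorFrame_spec κ
  exact flagVec_eq_self h4 (h5 j) (h3.spatialDot_flag_self κ.2.2.2.1 j)

/-- The spinors above a multiflag are characterised by linear equations and a norm. -/
theorem multiflagMap_eq_iff (κ : spinorSet n) (f : frameSet n) :
    multiflagMap κ = ⟦f⟧ ↔
      SpinorEquations f.1.1 (fun j => flagVec f.1.1 (f.1.2 j)) κ.1 ∧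
        dagger κ.1 κ.1 = algebraMap ℝ (Cl n) (f.1.1 0) := by
  obtain ⟨-, -, h3, h4, h5, h6⟩ := spinorFrame_spec κ
  rw [multiflagMap, mk_eq_mk_iff]
  simp only [flagVec_spinorFrame]
  constructor
  · rintro ⟨hp, hv⟩
    rw [← hp, h6]
    refine ⟨?_, rfl⟩
    have h7 : (spinorFrame κ).1.2 = fun j => flagVec (spinorFrame κ).1.1 (f.1.2 j) :=
      funext fun j => by rw [hv, hp]
    rw [← h7]
    exact h3
  · rintro ⟨h7, h8⟩
    have h0 : (spinorFrame κ).1.1 0 = f.1.1 0 := algebraMap_injective (h6.symm.trans h8)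
    have hκ : κ.1 ≠ 0 := κ.2.2.2.1
    -- The norm fixes the `T` coordinate; the equations then fix the spatial parts by faithfulness
    -- of the action on `κ`.
    refine ⟨eq_of_spinAct_eq hκ (by rw [h3.base, h7.base, h0]) h0, fun j => ?_⟩
    refine eq_of_spinAct_eq hκ (by rw [h3.flag, h7.flag, h0]) ?_
    rw [h5, flagVec_apply_zero (h0 ▸ h4.ne')]

theorem eq_smul_of_multiflagMap_eq {κ : spinorSet n} {f : frameSet n}
    (h : multiflagMap κ = ⟦f⟧) {μ : Fin 2 → Cl n}
    (hμ : SpinorEquations f.1.1 (fun j => flagVec f.1.1 (f.1.2 j)) μ) :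
    ∃ c : ℝ, μ = c • κ.1 := by
  have h1 := (multiflagMap_eq_iff κ f).mp h
  have h2 : (spinorFrame κ).1.1 = f.1.1 := ((mk_eq_mk_iff _ _).mp h).1
  exact eq_smul_of_spinorEquations (h2 ▸ (spinorFrame_spec κ).1) h1.2 f.2.1.2 h1.1 hμ

theorem dagger_smul (r : ℝ) (κ : Fin 2 → Cl n) :
    dagger (r • κ) (r • κ) = (r * r) • dagger κ κ := by
  simp only [dagger, Pi.smul_apply, conj_smul, smul_mul_assoc, mul_smul_comm, smul_smul,
    smul_add]

theorem multiflagMap_eq_multiflagMap_iff (κ₁ κ₂ : spinorSet n) :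
    multiflagMap κ₁ = multiflagMap κ₂ ↔ κ₂.1 = κ₁.1 ∨ κ₂.1 = -κ₁.1 := by
  obtain ⟨f, hf⟩ := Quotient.exists_rep (multiflagMap κ₁)
  rw [← hf, eq_comm, multiflagMap_eq_iff]
  have h1 := (multiflagMap_eq_iff κ₁ f).mp hf.symm
  constructor
  · rintro ⟨h2, h3⟩
    obtain ⟨c, hc⟩ := eq_smul_of_multiflagMap_eq hf.symm h2
    rw [hc, dagger_smul, h1.2, Algebra.smul_def, ← map_mul] at h3
    have h4 := algebraMap_injective h3
    have h5 : c * c = 1 := by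
      have := f.2.1.2.ne'
      field_simp at h4
      linarith
    rcases mul_self_eq_one_iff.mp h5 with rfl | rfl
    · exact Or.inl (by rw [hc, one_smul])
    · exact Or.inr (by rw [hc, neg_one_smul])
  · rintro (h | h)
    · rw [h]
      exact h1
    · have h' : κ₂.1 = (-1 : ℝ) • κ₁.1 := by rw [h, neg_one_smul]
      rw [h', dagger_smul, neg_mul_neg, one_mul, one_smul]
      exact ⟨h1.1.smul _, h1.2⟩

end Flags
end LipschitzSpinors
namespace LipschitzSpinors

/-! ### Every multiflag comes from a spinor -/

section Surjective

variable {n : ℕ}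

/-- Vectors orthogonal to `p` take the `T`-eigenspace of `p` to its `-T`-eigenspace, which in
`exists_base_solution` is where `κ̌` lies. -/
theorem spinAct_orthogonal {p u : Mink n} {κ : Fin 2 → Cl n} (hp : spinAct n p κ = p 0 • κ)
    (h : spatialDot p u = 0) : spinAct n p (spinAct n u κ) = -(p 0 • spinAct n u κ) := by
  have h1 := spinAct_add_swap p u κ
  rw [h, mul_zero, zero_smul, hp, map_smul] at h1
  exact eq_neg_of_add_eq_zero_left h1

/-- A solution of the base equation of the form `(1, W)` or `(0, 1)`, on which orthogonal
vectors act by paravectors. -/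
theorem exists_base_solution {p : Mink n} (h0 : 0 < p 0) (hp : spatialDot p p = p 0 * p 0) :
    ∃ κ : Fin 2 → Cl n, (∀ ζ, IsLipschitz ζ → (fun a => κ a * ζ) ∈ spinorSet n) ∧
      (∃ a, κ a = 1) ∧ spinAct n p κ = p 0 • κ ∧
      ∀ u : Mink n, spatialDot p u = 0 → ∃ c ∈ paravectors n,
        spinAct n u κ = (2 * p 0) • fun a => check κ a * c := by
  have hone : 2 * p 0 * ((p 0)⁻¹ * 2⁻¹) = 1 := by field_simp
  have hX := spatialDot_self p
  rw [hp] at hX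
  have hX' : paraPart n p * conj (paraPart n p) =
      algebraMap ℝ (Cl n) ((p 0 + p 1) * (p 0 - p 1)) := by
    rw [← sub_eq_iff_eq_add', ← map_sub] at hX
    rw [← hX]
    congr 1
    ring
  -- Nullity reads `X X̄ = (T + Z)(T - Z)`. If `T + Z = 0` then `X = 0` and `(0, 1)` solves the base
  -- equation; otherwise `(1, W)` does, with `W = X̄ / (T + Z)`.
  by_cases hs : p 0 + p 1 = 0
  · have hX0 : paraPart n p = 0 := by
      obtain ⟨r, h1, -, -, h2⟩ := exists_normSq (paraPart_mem p)
      by_contra hne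
      rw [hX', hs, zero_mul] at h1
      exact (h2 hne).ne (algebraMap_injective h1)
    have hbase : spinAct n p ![0, 1] = p 0 • ![0, 1] := by
      funext a
      fin_cases a
      · simp [spinAct_apply, hX0]
      · simp [spinAct_apply]
        rw [← neg_smul, ← eq_neg_of_add_eq_zero_left hs]
    refine ⟨![0, 1], fun ζ hζ => ?_, ⟨1, rfl⟩, hbase, fun u hu => ?_⟩
    · have h1 : (fun a => (![0, 1] : Fin 2 → Cl n) a * ζ) = ![0, ζ] := by
        funext a
        fin_cases a <;> simp
      rw [h1]
      exact mem_spinorSet_of_zero hζ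
    · refine ⟨(2 * p 0)⁻¹ • paraPart n u, smul_mem_paravectors _ (paraPart_mem u), ?_⟩
      have h1 := congrFun (spinAct_orthogonal hbase hu) 1
      have h2 : (2 * p 0) • (u 1 • (1 : Cl n)) = 0 := by
        simp [spinAct_apply, hX0] at h1
        rw [two_mul, add_smul]
        nth_rewrite 1 [← h1]
        rw [eq_neg_of_add_eq_zero_right hs]
        module
      have h3 : u 1 • (1 : Cl n) = 0 :=
        (smul_eq_zero.mp h2).resolve_left (by positivity)
      funext a
      fin_cases a
      · simp [spinAct_apply, check, smul_smul, hone]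
      · simp [spinAct_apply, check, h3]
  · have hX1 : conj (paraPart n p) = (p 0 + p 1) • ((p 0 + p 1)⁻¹ • conj (paraPart n p)) := by
      rw [smul_smul, mul_inv_cancel₀ hs, one_smul]
    set W : Cl n := (p 0 + p 1)⁻¹ • conj (paraPart n p) with hW
    have hWmem : W ∈ paravectors n :=
      smul_mem_paravectors _ (conj_mem_paravectors (paraPart_mem p))
    have hbase : spinAct n p ![1, W] = p 0 • ![1, W] := by
      funext a
      fin_cases a
      · simp [spinAct_apply]
        rw [hW, mul_smul_comm, hX', Algebra.algebraMap_eq_smul_one, smul_smul, ← mul_assoc,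
          inv_mul_cancel₀ hs]
        module
      · simp [spinAct_apply]
        rw [hX1]
        module
    refine ⟨![1, W], fun ζ hζ => ?_, ⟨0, rfl⟩, hbase, fun u hu => ?_⟩
    · have h1 : (fun a => (![1, W] : Fin 2 → Cl n) a * ζ) = ![ζ, W * ζ] := by
        funext a
        fin_cases a <;> simp
      rw [h1]
      exact mem_spinorSet_of_mul hζ hWmem
    -- The second entry of `κ̌` is `-1`, so the second coordinate dictates `c`; the first then
    -- agrees because the result lies in the `-T`-eigenspace.
    · refine ⟨(2 * p 0)⁻¹ • (u 1 • W - conj (paraPart n u)), smul_mem_paravectors _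
        (sub_mem_paravectors (smul_mem_paravectors _ hWmem)
          (conj_mem_paravectors (paraPart_mem u))), ?_⟩
      have h1 := congrFun (spinAct_orthogonal hbase hu) 0
      have hu1 : spinAct n u ![1, W] 1 = -(u 1 • W - conj (paraPart n u)) := by
        simp [spinAct_apply]
      have hpw : paraPart n p = (p 0 + p 1) • conj W := by
        rw [← conj_smul, ← hX1, conj_conj]
      have hu0 : spinAct n u ![1, W] 0 = conj W * (u 1 • W - conj (paraPart n u)) := by
        set κ := spinAct n u ![1, W] with hκ
        have h2 : p 1 • κ 0 + paraPart n p * κ 1 = -(p 0 • κ 0) := h1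
        rw [hu1, hpw, smul_mul_assoc, mul_neg, smul_neg] at h2
        refine smul_right_injective _ hs (?_ : (p 0 + p 1) • κ 0 = _)
        rw [add_smul, add_comm, ← sub_eq_zero]
        have h3 := sub_eq_zero.mpr h2
        rw [← h3]
        abel
      funext a
      fin_cases a
      · change spinAct n u ![1, W] 0 = _
        rw [hu0]
        simp [check, smul_smul, hone, gradeInv_eq_conj hWmem]
      · change spinAct n u ![1, W] 1 = _
        rw [hu1]
        simp [check, smul_smul, hone]

theorem exists_spinorEquations {p : Mink n} {u : Fin n → Mink n} (h0 : 0 < p 0)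
    (hp : spatialDot p p = p 0 * p 0) (hpu : ∀ j, spatialDot p (u j) = 0)
    (hu : ∀ j, spatialDot (u j) (u j) = 2 * p 0 * (2 * p 0))
    (ho : ∀ i j, i ≠ j → spatialDot (u i) (u j) = 0) :
    ∃ κ ∈ spinorSet n, SpinorEquations p u κ := by
  obtain ⟨κ, hmem, ⟨a, ha⟩, hbase, hc⟩ := exists_base_solution h0 hp
  choose c hcmem hc using fun j => hc (u j) (hpu j)
  -- Reading products of two actions at the coordinate where `κ` is `1` turns the Clifford relations
  -- of the `u j` into orthonormality of the `c j`.
  have hcomp : ∀ i j, spinAct n (u i) (spinAct n (u j) κ) a =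
      (2 * p 0 * (2 * p 0)) • (conj (c i) * c j) := by
    intro i j
    rw [hc j, map_smul, spinAct_mul_right]
    have h1 : spinAct n (u i) (check κ) = (2 * p 0) • fun a => κ a * conj (c i) := by
      rw [← neg_inj, ← check_spinAct, hc i, check_smul, check_mul_right, check_check,
        gradeInv_eq_conj (hcmem i), ← smul_neg]
      congr 1
      funext b
      simp
    rw [h1]
    simp only [Pi.smul_apply, ha, one_mul, smul_mul_assoc, smul_smul]
  have hsum : ∀ i j, (2 * p 0 * (2 * p 0)) • (conj (c i) * c j + conj (c j) * c i) =
      (2 * spatialDot (u i) (u j)) • (1 : Cl n) := by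
    intro i j
    rw [smul_add, ← hcomp, ← hcomp, ← Pi.add_apply, spinAct_add_swap, Pi.smul_apply, ha]
  have hpos : 2 * p 0 * (2 * p 0) ≠ 0 := by positivity
  -- The tuple `-c̄_j` is chosen so that the grade involution of `ζ i_j = -c̄_j ζ'` is the relation
  -- `ζ' i_j = c_j ζ` needed for `κ ζ`.
  obtain ⟨ζ, hζ, hζm⟩ := exists_isLipschitz_of_orthonormal (fun j => -conj (c j))
    (fun j => neg_mem_paravectors (conj_mem_paravectors (hcmem j)))
    (fun j => by
      have h1 := hsum j j
      rw [hu, ← two_smul ℝ (conj (c j) * c j), mul_comm 2 (2 * p 0 * (2 * p 0)),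
        mul_smul (2 * p 0 * (2 * p 0)) (2 : ℝ) (1 : Cl n)] at h1
      have h2 := smul_right_injective _ two_ne_zero (smul_right_injective _ hpos h1)
      simpa using h2)
    (fun i j hij => by
      have h1 := hsum i j
      rw [ho i j hij, mul_zero, zero_smul, smul_eq_zero] at h1
      simpa using h1.resolve_left hpos)
  refine ⟨fun a => κ a * ζ, hmem ζ hζ, ⟨?_, fun j => ?_⟩⟩
  · rw [spinAct_mul_right, hbase]
    funext b
    simp only [Pi.smul_apply, smul_mul_assoc]
  · have h1 : gradeInv ζ * gen n j = c j * ζ := by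
      have h2 := congrArg gradeInv (hζm j)
      simpa [gradeInv_eq_conj (conj_mem_paravectors (hcmem j))] using h2
    rw [spinAct_mul_right, checkGen_mul_right, hc j]
    funext b
    simp only [Pi.smul_apply, smul_mul_assoc, h1, mul_assoc]

theorem exists_multiflagMap_eq (f : frameSet n) : ∃ κ, multiflagMap κ = ⟦f⟧ := by
  obtain ⟨⟨hp, h0⟩, -⟩ := f.2
  obtain ⟨h1, h2, h3⟩ := flagVec_orthogonal f
  rw [mink_eq, sub_eq_zero, eq_comm] at hp
  obtain ⟨κ, hκ, heq⟩ := exists_spinorEquations h0 hp h1 h2 h3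
  obtain ⟨a, b, hab, -, -, hN⟩ := exists_normSq_of_mem_spinorSet hκ
  have hr : 0 < f.1.1 0 / (a + b) := div_pos h0 hab
  refine ⟨⟨_, smul_mem_spinorSet hκ (Real.sqrt_pos.mpr hr).ne'⟩,
    (multiflagMap_eq_iff _ _).mpr ⟨heq.smul _, ?_⟩⟩
  change dagger κ κ = _ at hN
  rw [dagger_smul, hN, Real.mul_self_sqrt hr.le, Algebra.smul_def, ← map_mul,
    div_mul_cancel₀ _ hab.ne']

end Surjective
end LipschitzSpinors
namespace LipschitzSpinors

/-! ### Smoothness -/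

section Smooth

variable {E V W X : Type*} [NormedAddCommGroup E] [NormedSpace ℝ E]
  [NormedAddCommGroup V] [NormedSpace ℝ V] [NormedAddCommGroup W] [NormedSpace ℝ W]
  [NormedAddCommGroup X] [NormedSpace ℝ X]

theorem contDiffOn_linearMap [FiniteDimensional ℝ V] (L : V →ₗ[ℝ] W) {f : E → V} {s : Set E}
    (hf : ContDiffOn ℝ ∞ f s) : ContDiffOn ℝ ∞ (fun x => L (f x)) s :=
  L.toContinuousLinearMap.contDiff.comp_contDiffOn hf

theorem contDiffOn_bilinear [FiniteDimensional ℝ V] [FiniteDimensional ℝ W]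
    (B : V →ₗ[ℝ] W →ₗ[ℝ] X) {f : E → V} {g : E → W} {s : Set E}
    (hf : ContDiffOn ℝ ∞ f s) (hg : ContDiffOn ℝ ∞ g s) :
    ContDiffOn ℝ ∞ (fun x => B (f x) (g x)) s :=
  B.toContinuousBilinearMap.isBoundedBilinearMap.contDiff.comp_contDiffOn (hf.prodMk hg)

variable {n : ℕ}

/-- The pairing `(κ, μ) ↦ κ μ†`. -/
noncomputable def outerForm (n : ℕ) :
    (Fin 2 → Cl n) →ₗ[ℝ] (Fin 2 → Cl n) →ₗ[ℝ] (Fin 2 → Fin 2 → Cl n) :=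
  LinearMap.mk₂ ℝ (fun κ μ a b => κ a * conj (μ b))
    (fun _ _ _ => by
      funext a b
      simp [add_mul])
    (fun _ _ _ => by
      funext a b
      simp)
    (fun _ _ _ => by
      funext a b
      simp [mul_add])
    (fun _ _ _ => by
      funext a b
      simp)

theorem outerDeriv_eq (κ μ : Fin 2 → Cl n) :
    outerDeriv κ μ = outerForm n μ κ + outerForm n κ μ := rfl

theorem fderiv_outer (κ μ : Fin 2 → Cl n) : fderiv ℝ outer κ μ = outerDeriv κ μ := by
  have h := (outerForm n).toContinuousBilinearMap.hasFDerivAt_of_bilinear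
    (hasFDerivAt_id (𝕜 := ℝ) κ) (hasFDerivAt_id (𝕜 := ℝ) κ)
  have h1 : HasFDerivAt (outer : (Fin 2 → Cl n) → Fin 2 → Fin 2 → Cl n) _ κ := h
  rw [h1.fderiv, outerDeriv_eq, add_comm]
  rfl

/-- `hermMatrix` as a linear map. -/
noncomputable def hermLinear (n : ℕ) : Mink n →ₗ[ℝ] (Fin 2 → Fin 2 → Cl n) where
  toFun := hermMatrix
  map_add' p q := by
    obtain ⟨h1, h2, h3, h4⟩ := hermMatrix_apply (p + q)
    obtain ⟨h5, h6, h7, h8⟩ := hermMatrix_apply p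
    obtain ⟨h9, h10, h11, h12⟩ := hermMatrix_apply q
    funext a b
    fin_cases a <;> fin_cases b <;>
    simp only [Fin.zero_eta, Fin.mk_one, Pi.add_apply, h1, h2, h3, h4, h5, h6, h7, h8, h9, h10,
      h11, h12, ← smul_add, ← map_add, ← conj_add]
    · congr 2
      ring
    · congr 2
      ring
  map_smul' r p := by
    obtain ⟨h1, h2, h3, h4⟩ := hermMatrix_apply (r • p)
    obtain ⟨h5, h6, h7, h8⟩ := hermMatrix_apply p
    funext a b
    fin_cases a <;> fin_cases b <;>
    simp only [Fin.zero_eta, Fin.mk_one, Pi.smul_apply, h1, h2, h3, h4, h5, h6, h7, h8, map_smul,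
      conj_smul, smul_comm r, RingHom.id_apply, smul_eq_mul, ← mul_add, ← mul_sub]
    · rw [map_mul, ← Algebra.smul_def, smul_comm]
    · rw [map_mul, ← Algebra.smul_def, smul_comm]

theorem hermLinear_ker : LinearMap.ker (hermLinear n) = ⊥ := by
  rw [LinearMap.ker_eq_bot']
  intro p hp
  have hp' : hermMatrix p = 0 := hp
  obtain ⟨h1, h2, -, h4⟩ := hermMatrix_apply p
  rw [hp', Pi.zero_apply, Pi.zero_apply, eq_comm, smul_eq_zero] at h1 h2 h4
  have h5 := (map_eq_zero_iff _ algebraMap_injective).mp (h1.resolve_left (by norm_num))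
  have h6 := (map_eq_zero_iff _ algebraMap_injective).mp (h4.resolve_left (by norm_num))
  have hp0 : p 0 = 0 := by linarith
  have hp1 : p 1 = 0 := by linarith
  refine eq_of_spatialDot_sub_self ?_ hp0
  rw [sub_zero]
  apply algebraMap_injective (n := n)
  rw [spatialDot_self, h2.resolve_left (by norm_num), hp1]
  simp

/-- A linear left inverse of `hermMatrix`. -/
noncomputable def hermInv (n : ℕ) : (Fin 2 → Fin 2 → Cl n) →ₗ[ℝ] Mink n :=
  ((hermLinear n).exists_leftInverse_of_injective hermLinear_ker).choose

theorem hermInv_hermMatrix (p : Mink n) : hermInv n (hermMatrix p) = p :=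
  LinearMap.congr_fun
    ((hermLinear n).exists_leftInverse_of_injective hermLinear_ker).choose_spec p

/-- The frame of a spinor as a polynomial map. -/
noncomputable def frameFormula (κ : Fin 2 → Cl n) : Mink n × (Fin n → Mink n) :=
  (hermInv n (outer κ), fun j => hermInv n (outerDeriv κ (checkGen j κ)))

theorem spinorFrame_eq (κ : spinorSet n) : (spinorFrame κ).1 = frameFormula κ.1 := by
  obtain ⟨h1, h2, -⟩ := spinorFrame_spec κ
  refine Prod.ext ?_ (funext fun j => ?_)
  · rw [frameFormula, ← h1, hermInv_hermMatrix]
  · simp only [frameFormula]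
    rw [← h2, hermInv_hermMatrix]

theorem contDiff_frameFormula :
    ContDiff ℝ ∞ (frameFormula : (Fin 2 → Cl n) → Mink n × (Fin n → Mink n)) := by
  rw [← contDiffOn_univ]
  have hid : ContDiffOn ℝ ∞ (fun κ : Fin 2 → Cl n => κ) Set.univ := contDiffOn_id
  have hc : ∀ j : Fin n, ContDiffOn ℝ ∞ (fun κ : Fin 2 → Cl n => checkGen j κ) Set.univ :=
    fun j => contDiffOn_linearMap (checkGen j) hid
  refine ContDiffOn.prodMk (contDiffOn_linearMap _ (contDiffOn_bilinear (outerForm n) hid hid))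
    (contDiffOn_pi.mpr fun j => contDiffOn_linearMap _
      ((contDiffOn_bilinear (outerForm n) (hc j) hid).add
        (contDiffOn_bilinear (outerForm n) hid (hc j))))

theorem continuous_spinorFrame : Continuous (spinorFrame : spinorSet n → frameSet n) := by
  rw [continuous_induced_rng]
  have h : (Subtype.val ∘ spinorFrame : spinorSet n → Mink n × (Fin n → Mink n)) =
      frameFormula ∘ Subtype.val := funext spinorFrame_eq
  rw [h]
  exact contDiff_frameFormula.continuous.comp continuous_subtype_val

theorem continuous_multiflagMap : Continuous (multiflagMap : spinorSet n → Multiflag n) :=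
  continuous_quotient_mk'.comp continuous_spinorFrame

theorem smoothToMultiflag_multiflagMap : SmoothToMultiflag (multiflagMap (n := n)) := by
  refine fun κ => ⟨Set.univ, isOpen_univ, Set.mem_univ _, fun x => spinorFrame x.1, ?_,
    fun x => rfl⟩
  exact fun x => ⟨Set.univ, isOpen_univ, Set.mem_univ _, frameFormula,
    contDiff_frameFormula.contDiffOn, fun y _ => (spinorFrame_eq ⟨y.1, y.2.1⟩).symm⟩

/-! ### Projection onto the solutions of the spinor equations -/

/-- Successive averages over involutions. -/
noncomputable def average {M ι : Type*} [AddCommGroup M] [Module ℝ M] (T : ι → Module.End ℝ M)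
    (L : List ι) (x : M) : M :=
  L.foldr (fun i y => (1 / 2 : ℝ) • (y + T i y)) x

theorem average_eq_self {M ι : Type*} [AddCommGroup M] [Module ℝ M] {T : ι → Module.End ℝ M}
    (L : List ι) {x : M} (h : ∀ i, T i x = x) : average T L x = x := by
  induction L with
  | nil => rfl
  | cons i L ih =>
    change (1 / 2 : ℝ) • (average T L x + T i (average T L x)) = x
    rw [ih, h, ← two_smul ℝ x, smul_smul]
    norm_num

/-- Each factor `½(1 + T i)` is fixed by `T i`, and commutation carries this past the other factors.
-/
theorem apply_average {M ι : Type*} [AddCommGroup M] [Module ℝ M] {T : ι → Module.End ℝ M}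
    (hsq : ∀ i x, T i (T i x) = x) (hcomm : ∀ i j x, T i (T j x) = T j (T i x)) (L : List ι)
    (x : M) {i : ι} (hi : i ∈ L) : T i (average T L x) = average T L x := by
  induction L with
  | nil => simp at hi
  | cons j L ih =>
    change T i ((1 / 2 : ℝ) • (average T L x + T j (average T L x))) =
      (1 / 2 : ℝ) • (average T L x + T j (average T L x))
    rw [map_smul, map_add]
    rcases List.mem_cons.mp hi with rfl | hi
    · rw [hsq, add_comm]
    · rw [hcomm, ih hi]

theorem contDiffOn_average {ι : Type*} {T : E → ι → Module.End ℝ V} {s : Set E}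
    (hT : ∀ (i : ι) (g : E → V), ContDiffOn ℝ ∞ g s → ContDiffOn ℝ ∞ (fun x => T x i (g x)) s)
    (L : List ι) (v : V) : ContDiffOn ℝ ∞ (fun x => average (T x) L v) s := by
  induction L with
  | nil => exact contDiffOn_const
  | cons i L ih => exact contDiffOn_const.smul (ih.add (hT i _ ih))

/-- The commuting involutions whose common fixed vectors solve the spinor equations. -/
noncomputable def spinorInvolution (f : Mink n × (Fin n → Mink n)) :
    Fin (n + 1) → Module.End ℝ (Fin 2 → Cl n) :=
  Fin.cons ((f.1 0)⁻¹ • spinAct n f.1) fun j =>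
    (2 * f.1 0)⁻¹ • spinAct n (flagVec f.1 (f.2 j)) ∘ₗ checkGen j

theorem spinorInvolution_zero (f : Mink n × (Fin n → Mink n)) (κ : Fin 2 → Cl n) :
    spinorInvolution f 0 κ = (f.1 0)⁻¹ • spinAct n f.1 κ := rfl

theorem spinorInvolution_succ (f : Mink n × (Fin n → Mink n)) (j : Fin n)
    (κ : Fin 2 → Cl n) : spinorInvolution f j.succ κ =
      (2 * f.1 0)⁻¹ • spinAct n (flagVec f.1 (f.2 j)) (checkGen j κ) := rfl

/-- For the flag operators two minus signs cancel: `checkGen j` anticommutes with the action and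
squares to `-1`. -/
theorem spinorInvolution_sq (f : frameSet n) (i : Fin (n + 1)) (κ : Fin 2 → Cl n) :
    spinorInvolution f.1 i (spinorInvolution f.1 i κ) = κ := by
  obtain ⟨⟨hp, h0⟩, -⟩ := f.2
  obtain ⟨h1, h2, h3⟩ := flagVec_orthogonal f
  rw [mink_eq, sub_eq_zero, eq_comm] at hp
  induction i using Fin.cases with
  | zero =>
    simp only [spinorInvolution_zero]
    rw [map_smul, spinAct_sq, hp, smul_smul, smul_smul]
    have h : (f.1.1 0)⁻¹ * (f.1.1 0)⁻¹ * (f.1.1 0 * f.1.1 0) = 1 := by field_simp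
    rw [h, one_smul]
  | succ j =>
    simp only [spinorInvolution_succ]
    rw [map_smul, map_smul, checkGen_spinAct, map_neg, spinAct_sq, h2, checkGen_sq, smul_smul,
      smul_neg, smul_neg, smul_neg, neg_neg, smul_smul]
    have h : (2 * f.1.1 0)⁻¹ * (2 * f.1.1 0)⁻¹ * (2 * f.1.1 0 * (2 * f.1.1 0)) = 1 := by
      field_simp
    rw [h, one_smul]

/-- Orthogonal vectors anticommute. This sign is cancelled by `checkGen` anticommuting with the
action, or, between two flags, by `checkGen i` anticommuting with `checkGen j`. -/
theorem spinorInvolution_comm (f : frameSet n) (i j : Fin (n + 1)) (κ : Fin 2 → Cl n) :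
    spinorInvolution f.1 i (spinorInvolution f.1 j κ) =
      spinorInvolution f.1 j (spinorInvolution f.1 i κ) := by
  obtain ⟨h1, h2, h3⟩ := flagVec_orthogonal f
  have hswap : ∀ (v w : Mink n) (μ : Fin 2 → Cl n), spatialDot v w = 0 →
      spinAct n v (spinAct n w μ) = -spinAct n w (spinAct n v μ) := by
    intro v w μ h
    have := spinAct_add_swap v w μ
    rw [h, mul_zero, zero_smul] at this
    exact eq_neg_of_add_eq_zero_left this
  have key : ∀ j : Fin n, spinorInvolution f.1 0 (spinorInvolution f.1 j.succ κ) =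
      spinorInvolution f.1 j.succ (spinorInvolution f.1 0 κ) := by
    intro j
    simp only [spinorInvolution_zero, spinorInvolution_succ]
    rw [map_smul, map_smul, map_smul, checkGen_spinAct, map_neg, hswap _ _ _ (h1 j), smul_comm]
  induction i using Fin.cases with
  | zero =>
    induction j using Fin.cases with
    | zero => rfl
    | succ j => exact key j
  | succ i =>
    induction j using Fin.cases with
    | zero => exact (key i).symm
    | succ j =>
      by_cases hij : i = j
      · rw [hij]
      · simp only [spinorInvolution_succ]
        simp only [map_smul, checkGen_spinAct, map_neg]
        rw [hswap _ _ _ (h3 i j hij), checkGen_swap hij]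
        simp only [map_neg, neg_neg]

/-- Applying `checkGen j` moves it from one side of a flag equation to the other. -/
theorem spinorEquations_iff (f : frameSet n) (κ : Fin 2 → Cl n) :
    SpinorEquations f.1.1 (fun j => flagVec f.1.1 (f.1.2 j)) κ ↔
      ∀ i, spinorInvolution f.1 i κ = κ := by
  have h0 : 0 < f.1.1 0 := f.2.1.2
  have h2 : (2 * f.1.1 0) ≠ 0 := by positivity
  have key : ∀ j, spinorInvolution f.1 j.succ κ = κ ↔
      spinAct n (flagVec f.1.1 (f.1.2 j)) κ = (2 * f.1.1 0) • checkGen j κ := by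
    intro j
    rw [spinorInvolution_succ, inv_smul_eq_iff₀ h2]
    constructor
    · intro h
      have h3 := congrArg (checkGen j) h
      rw [checkGen_spinAct, checkGen_sq, map_neg, neg_neg, map_smul] at h3
      exact h3
    · intro h
      have h3 := congrArg (checkGen j) h
      rw [checkGen_spinAct, map_smul, checkGen_sq, smul_neg, neg_inj] at h3
      exact h3
  have key0 : spinorInvolution f.1 0 κ = κ ↔ spinAct n f.1.1 κ = f.1.1 0 • κ := by
    rw [spinorInvolution_zero, inv_smul_eq_iff₀ h0.ne']
  constructor
  · intro h i
    induction i using Fin.cases with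
    | zero => exact key0.mpr h.base
    | succ j => exact (key j).mpr (h.flag j)
  · exact fun h => ⟨key0.mp (h 0), fun j => (key j).mp (h j.succ)⟩

/-- The projection of `κ` to the solutions of the spinor equations of `f`. -/
noncomputable def spinorProj (κ : Fin 2 → Cl n) (f : Mink n × (Fin n → Mink n)) :
    Fin 2 → Cl n :=
  average (spinorInvolution f) (List.finRange (n + 1)) κ

theorem spinorEquations_spinorProj (κ : Fin 2 → Cl n) (f : frameSet n) :
    SpinorEquations f.1.1 (fun j => flagVec f.1.1 (f.1.2 j)) (spinorProj κ f.1) :=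
  (spinorEquations_iff f _).mpr fun i => apply_average (spinorInvolution_sq f)
    (spinorInvolution_comm f) _ κ (List.mem_finRange i)

/-- An open set of tuples on which the normalised flag vectors are smooth. -/
def nondegenerate (n : ℕ) : Set (Mink n × (Fin n → Mink n)) :=
  {f | 0 < f.1 0 ∧ ∀ j, 0 < spatialDot (spatialRep f.1 (f.2 j)) (spatialRep f.1 (f.2 j))}

theorem frameSet_subset_nondegenerate : frameSet n ⊆ nondegenerate n := fun f hf =>
  ⟨hf.1.2, fun j => spatialDot_spatialRep_pos hf.1.2.ne' (mk_ne_zero_of_frame ⟨f, hf⟩ j)⟩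

theorem contDiffOn_base (s : Set (Mink n × (Fin n → Mink n))) :
    ContDiffOn ℝ ∞ (fun f : Mink n × (Fin n → Mink n) => f.1) s := contDiff_fst.contDiffOn

theorem contDiffOn_base_zero (s : Set (Mink n × (Fin n → Mink n))) :
    ContDiffOn ℝ ∞ (fun f : Mink n × (Fin n → Mink n) => f.1 0) s :=
  contDiffOn_linearMap (LinearMap.proj 0) (contDiffOn_base s)

theorem contDiffOn_spatialRep {s : Set (Mink n × (Fin n → Mink n))} (hs : ∀ f ∈ s, 0 < f.1 0)
    (j : Fin n) : ContDiffOn ℝ ∞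
      (fun f : Mink n × (Fin n → Mink n) => spatialRep f.1 (f.2 j)) s := by
  have h1 : ContDiffOn ℝ ∞ (fun f : Mink n × (Fin n → Mink n) => f.2 j) s :=
    contDiffOn_linearMap (LinearMap.proj j : (Fin n → Mink n) →ₗ[ℝ] Mink n)
      contDiff_snd.contDiffOn
  have h2 : ContDiffOn ℝ ∞ (fun f : Mink n × (Fin n → Mink n) => f.2 j 0) s :=
    contDiffOn_linearMap (LinearMap.proj 0) h1
  exact h1.sub ((h2.div (contDiffOn_base_zero s) fun f hf => (hs f hf).ne').smul
    (contDiffOn_base s))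

theorem isOpen_nondegenerate : IsOpen (nondegenerate n) := by
  have h1 : IsOpen {f : Mink n × (Fin n → Mink n) | 0 < f.1 0} :=
    isOpen_lt continuous_const (by fun_prop)
  have h2 : ∀ j : Fin n, IsOpen ({f : Mink n × (Fin n → Mink n) | 0 < f.1 0} ∩
      {f | 0 < spatialDot (spatialRep f.1 (f.2 j)) (spatialRep f.1 (f.2 j))}) := by
    intro j
    have h3 := contDiffOn_spatialRep (n := n) (s := {f | 0 < f.1 0}) (fun f hf => hf) j
    exact (contDiffOn_bilinear (spatialForm n) h3 h3).continuousOn.isOpen_inter_preimage h1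
      isOpen_Ioi
  have h3 : nondegenerate n = {f : Mink n × (Fin n → Mink n) | 0 < f.1 0} ∩
      ⋂ j : Fin n, ({f : Mink n × (Fin n → Mink n) | 0 < f.1 0} ∩
        {f | 0 < spatialDot (spatialRep f.1 (f.2 j)) (spatialRep f.1 (f.2 j))}) := by
    ext f
    simp only [nondegenerate, Set.mem_ofPred_eq, Set.mem_inter_iff, Set.mem_iInter]
    exact ⟨fun h => ⟨h.1, fun j => ⟨h.1, h.2 j⟩⟩, fun h => ⟨h.1, fun j => (h.2 j).2⟩⟩
  rw [h3]
  exact h1.inter (isOpen_iInter_of_finite h2)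

theorem contDiffOn_flagVec (j : Fin n) : ContDiffOn ℝ ∞
    (fun f : Mink n × (Fin n → Mink n) => flagVec f.1 (f.2 j)) (nondegenerate n) := by
  have h1 := contDiffOn_spatialRep (n := n) (s := nondegenerate n) (fun f hf => hf.1) j
  have h2 := contDiffOn_bilinear (spatialForm n) h1 h1
  exact ((contDiffOn_const.mul (contDiffOn_base_zero _)).div
    (h2.sqrt fun f hf => (hf.2 j).ne') fun f hf => (Real.sqrt_pos.mpr (hf.2 j)).ne').smul h1

theorem contDiffOn_spinorProj (κ : Fin 2 → Cl n) :
    ContDiffOn ℝ ∞ (spinorProj κ) (nondegenerate n) := by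
  refine contDiffOn_average (fun i g hg => ?_) _ κ
  induction i using Fin.cases with
  | zero =>
    exact ((contDiffOn_base_zero _).inv fun f hf => hf.1.ne').smul
      (contDiffOn_bilinear (spinAct n) (contDiffOn_base _) hg)
  | succ j =>
    exact ((contDiffOn_const.mul (contDiffOn_base_zero _)).inv
      fun f hf => (mul_pos two_pos hf.1).ne').smul
      (contDiffOn_bilinear (spinAct n) (contDiffOn_flagVec j)
        (contDiffOn_linearMap (checkGen j) hg))

/-- `κ† μ` as a bilinear map. -/
noncomputable def daggerForm (n : ℕ) : (Fin 2 → Cl n) →ₗ[ℝ] (Fin 2 → Cl n) →ₗ[ℝ] Cl n :=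
  LinearMap.mk₂ ℝ dagger
    (fun _ _ _ => by simp [dagger, add_mul]; abel)
    (fun _ _ _ => by simp [dagger])
    (fun _ _ _ => by simp [dagger, mul_add]; abel)
    (fun _ _ _ => by simp [dagger])

/-- A linear projection of the Clifford algebra to the real numbers. -/
noncomputable def realPart (n : ℕ) : Cl n →ₗ[ℝ] ℝ :=
  ((Algebra.linearMap ℝ (Cl n)).exists_leftInverse_of_injective
    (LinearMap.ker_eq_bot.mpr algebraMap_injective)).choose

theorem realPart_algebraMap (r : ℝ) : realPart n (algebraMap ℝ (Cl n) r) = r :=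
  LinearMap.congr_fun ((Algebra.linearMap ℝ (Cl n)).exists_leftInverse_of_injective
    (LinearMap.ker_eq_bot.mpr algebraMap_injective)).choose_spec r

/-- The squared norm of the projection of `κ`. -/
noncomputable def projNorm (κ : Fin 2 → Cl n) (f : Mink n × (Fin n → Mink n)) : ℝ :=
  realPart n (dagger (spinorProj κ f) (spinorProj κ f))

theorem contDiffOn_projNorm (κ : Fin 2 → Cl n) :
    ContDiffOn ℝ ∞ (projNorm κ) (nondegenerate n) :=
  contDiffOn_linearMap (realPart n) (contDiffOn_bilinear (daggerForm n)
    (contDiffOn_spinorProj κ) (contDiffOn_spinorProj κ))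

/-- The rescaled projection, a local section of `multiflagMap`. -/
noncomputable def spinorSection (κ : Fin 2 → Cl n) (f : Mink n × (Fin n → Mink n)) :
    Fin 2 → Cl n :=
  Real.sqrt (f.1 0 / projNorm κ f) • spinorProj κ f

/-- The domain of `spinorSection`. -/
def sectionDomain (κ : Fin 2 → Cl n) : Set (Mink n × (Fin n → Mink n)) :=
  nondegenerate n ∩ {f | 0 < projNorm κ f}

theorem isOpen_sectionDomain (κ : Fin 2 → Cl n) : IsOpen (sectionDomain κ) :=
  (contDiffOn_projNorm κ).continuousOn.isOpen_inter_preimage isOpen_nondegenerate isOpen_Ioi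

theorem contDiffOn_spinorSection (κ : Fin 2 → Cl n) :
    ContDiffOn ℝ ∞ (spinorSection κ) (sectionDomain κ) := by
  have hle : sectionDomain κ ⊆ nondegenerate n := Set.inter_subset_left
  exact (((contDiffOn_base_zero _).div ((contDiffOn_projNorm κ).mono hle)
    fun f hf => (Set.mem_ofPred.mp hf.2).ne').sqrt
      fun f hf => (div_pos hf.1.1 hf.2).ne').smul ((contDiffOn_spinorProj κ).mono hle)

/-- The projection only yields a solution in `Cl²`. It is a Lipschitz spinor because some spinor `μ`
lies over the multiflag and all solutions are real multiples of `μ`. -/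
theorem spinorSection_spec (κ : Fin 2 → Cl n) (f : frameSet n) (hf : f.1 ∈ sectionDomain κ) :
    ∃ h : spinorSection κ f.1 ∈ spinorSet n, multiflagMap ⟨_, h⟩ = ⟦f⟧ := by
  obtain ⟨μ, hμ⟩ := exists_multiflagMap_eq f
  have h1 := spinorEquations_spinorProj κ f
  obtain ⟨c, hc⟩ := eq_smul_of_multiflagMap_eq hμ h1
  have hpos : 0 < projNorm κ f.1 := hf.2
  have h2 := ((multiflagMap_eq_iff μ f).mp hμ).2
  have h3 : dagger (spinorProj κ f.1) (spinorProj κ f.1) =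
      algebraMap ℝ (Cl n) (projNorm κ f.1) := by
    rw [projNorm, hc, dagger_smul, h2, Algebra.smul_def, ← map_mul, realPart_algebraMap]
  have hc0 : c ≠ 0 := by
    rintro rfl
    rw [hc, zero_smul] at h3
    have h4 : dagger (0 : Fin 2 → Cl n) 0 = 0 := by simp [dagger]
    rw [h4, eq_comm, map_eq_zero_iff _ algebraMap_injective] at h3
    exact hpos.ne' h3
  have hr : 0 < f.1.1 0 / projNorm κ f.1 := div_pos f.2.1.2 hpos
  have hmem : spinorSection κ f.1 ∈ spinorSet n := by
    rw [spinorSection, hc]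
    exact smul_mem_spinorSet (smul_mem_spinorSet μ.2 hc0) (Real.sqrt_pos.mpr hr).ne'
  refine ⟨hmem, (multiflagMap_eq_iff _ f).mpr ⟨h1.smul _, ?_⟩⟩
  change dagger (_ • _) (_ • _) = _
  rw [dagger_smul, h3, Real.mul_self_sqrt hr.le, Algebra.smul_def, ← map_mul,
    div_mul_cancel₀ _ hpos.ne']

/-- The projection fixes `κ` over its own multiflag, so the norm there is `T > 0`. -/
theorem mem_sectionDomain_self {κ : spinorSet n} {f : frameSet n} (h : multiflagMap κ = ⟦f⟧) :
    f.1 ∈ sectionDomain κ.1 := by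
  have h1 := (multiflagMap_eq_iff κ f).mp h
  refine ⟨frameSet_subset_nondegenerate f.2, ?_⟩
  change 0 < projNorm κ.1 f.1
  have h2 : spinorProj κ.1 f.1 = κ.1 :=
    average_eq_self _ ((spinorEquations_iff f κ.1).mp h1.1)
  rw [projNorm, h2, h1.2, realPart_algebraMap]
  exact f.2.1.2

theorem spinorProj_congr (κ : Fin 2 → Cl n) {f g : frameSet n}
    (h : (⟦f⟧ : Multiflag n) = ⟦g⟧) : spinorProj κ f.1 = spinorProj κ g.1 := by
  obtain ⟨h1, h2⟩ := (mk_eq_mk_iff f g).mp h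
  have h3 : spinorInvolution f.1 = spinorInvolution g.1 := by
    refine funext fun i => LinearMap.ext fun μ => ?_
    induction i using Fin.cases with
    | zero => rw [spinorInvolution_zero, spinorInvolution_zero, h1]
    | succ j => rw [spinorInvolution_succ, spinorInvolution_succ, h2, h1]
  rw [spinorProj, h3, spinorProj]

/-- The section sees a frame only through its base-point and normalised flag vectors, so it descends
to multiflags. -/
theorem spinorSection_congr (κ : Fin 2 → Cl n) {f g : frameSet n}
    (h : (⟦f⟧ : Multiflag n) = ⟦g⟧) : spinorSection κ f.1 = spinorSection κ g.1 := by
  rw [spinorSection, spinorSection, projNorm, projNorm, spinorProj_congr κ h,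
    ((mk_eq_mk_iff f g).mp h).1]

theorem mem_sectionDomain_congr (κ : Fin 2 → Cl n) {f g : frameSet n}
    (h : (⟦f⟧ : Multiflag n) = ⟦g⟧) : f.1 ∈ sectionDomain κ ↔ g.1 ∈ sectionDomain κ := by
  simp only [sectionDomain, Set.mem_inter_iff, frameSet_subset_nondegenerate f.2,
    frameSet_subset_nondegenerate g.2, Set.mem_ofPred_eq, projNorm, spinorProj_congr κ h]

end Smooth
end LipschitzSpinors
namespace LipschitzSpinors

/-! ### The double cover -/

section DoubleCover

variable {n : ℕ}

/-- The multiflags over which `spinorSection` is defined. -/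
def sectionBase (κ : Fin 2 → Cl n) : Set (Multiflag n) :=
  {F | ∃ f : frameSet n, ⟦f⟧ = F ∧ f.1 ∈ sectionDomain κ}

theorem mk_mem_sectionBase {κ : Fin 2 → Cl n} {f : frameSet n} :
    (⟦f⟧ : Multiflag n) ∈ sectionBase κ ↔ f.1 ∈ sectionDomain κ :=
  ⟨fun ⟨_, hg, h⟩ => (mem_sectionDomain_congr κ hg).mp h, fun h => ⟨f, rfl, h⟩⟩

theorem isOpen_sectionBase (κ : Fin 2 → Cl n) : IsOpen (sectionBase κ) := by
  rw [← isQuotientMap_quotient_mk'.isOpen_preimage]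
  have h : (Quotient.mk' ⁻¹' sectionBase κ : Set (frameSet n)) =
      Subtype.val ⁻¹' sectionDomain κ := Set.ext fun f => mk_mem_sectionBase
  rw [h]
  exact (isOpen_sectionDomain κ).preimage continuous_subtype_val

/-- The sheet of the double cover through the multiple by the sign `ε` of the section. -/
def sheet (κ : Fin 2 → Cl n) (ε : ℝ) : Set (spinorSet n) :=
  {μ | multiflagMap μ ∈ sectionBase κ ∧ spinorSection κ (spinorFrame μ).1 = ε • μ.1}

theorem spinorSection_spinorFrame (κ : Fin 2 → Cl n) {μ : spinorSet n}
    (h : multiflagMap μ ∈ sectionBase κ) :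
    spinorSection κ (spinorFrame μ).1 = μ.1 ∨ spinorSection κ (spinorFrame μ).1 = -μ.1 := by
  obtain ⟨hmem, heq⟩ := spinorSection_spec κ (spinorFrame μ) (mk_mem_sectionBase.mp h)
  exact (multiflagMap_eq_multiflagMap_iff μ ⟨_, hmem⟩).mp heq.symm

/-- The section equals `±μ` everywhere over its base, so the closed condition "equal to `ε μ`" is
the same as the open condition "different from `-ε μ`". -/
theorem isOpen_sheet (κ : Fin 2 → Cl n) {ε : ℝ} (hε : ε = 1 ∨ ε = -1) :
    IsOpen (sheet κ ε) := by
  have h1 : IsOpen (multiflagMap ⁻¹' sectionBase κ) :=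
    (isOpen_sectionBase κ).preimage continuous_multiflagMap
  have h2 : ContinuousOn
      (fun μ : spinorSet n => spinorSection κ (spinorFrame μ).1 + ε • μ.1)
      (multiflagMap ⁻¹' sectionBase κ) := by
    refine ContinuousOn.add ?_ (continuous_subtype_val.const_smul ε).continuousOn
    exact (contDiffOn_spinorSection κ).continuousOn.comp
      (continuous_subtype_val.comp continuous_spinorFrame).continuousOn
      fun μ hμ => mk_mem_sectionBase.mp hμ
  have h3 : sheet κ ε = multiflagMap ⁻¹' sectionBase κ ∩
      (fun μ : spinorSet n => spinorSection κ (spinorFrame μ).1 + ε • μ.1) ⁻¹' {0}ᶜ := by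
    ext μ
    refine and_congr_right fun hμ => ?_
    have hne : μ.1 ≠ 0 := μ.2.2.2.1
    have hne2 : (2 : ℝ) • μ.1 ≠ 0 := smul_ne_zero two_ne_zero hne
    have h4 : -μ.1 ≠ μ.1 := fun h => hne2 (by
      rw [two_smul]
      nth_rewrite 1 [← h]
      exact neg_add_cancel _)
    change _ ↔ spinorSection κ (spinorFrame μ).1 + ε • μ.1 ≠ 0
    rcases hε with rfl | rfl <;> rcases spinorSection_spinorFrame κ hμ with h | h
    · simp only [h, one_smul, true_iff, ← two_smul ℝ μ.1]
      exact hne2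
    · simp [h, h4]
    · simp [h, h4.symm]
    · simp only [h, neg_one_smul, true_iff, ← neg_add, ← two_smul ℝ μ.1]
      exact neg_ne_zero.mpr hne2
  rw [h3]
  exact h2.isOpen_inter_preimage h1 isOpen_compl_singleton

open Classical in
/-- The inverse of `multiflagMap` on a sheet. -/
noncomputable def sheetInv (κ : spinorSet n) (ε : ℝ) (F : Multiflag n) : spinorSet n :=
  -- The fallback `κ` only makes the map total; over `sectionBase κ.1` the first branch always
  -- applies when `ε ≠ 0`.
  if h : ε • spinorSection κ.1 F.out.1 ∈ spinorSet n then ⟨_, h⟩ else κ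

theorem sheetInv_mk (κ : spinorSet n) {ε : ℝ} (hε : ε ≠ 0) (f : frameSet n)
    (hf : f.1 ∈ sectionDomain κ.1) :
    (sheetInv κ ε ⟦f⟧).1 = ε • spinorSection κ.1 f.1 := by
  have h1 : spinorSection κ.1 (⟦f⟧ : Multiflag n).out.1 = spinorSection κ.1 f.1 :=
    spinorSection_congr κ.1 (Quotient.out_eq _)
  have h2 : ε • spinorSection κ.1 (⟦f⟧ : Multiflag n).out.1 ∈ spinorSet n := by
    rw [h1]
    exact smul_mem_spinorSet (spinorSection_spec κ.1 f hf).1 hε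
  rw [sheetInv, dif_pos h2]
  exact congrArg (ε • ·) h1

theorem multiflagMap_sheetInv (κ : spinorSet n) {ε : ℝ} (hε : ε = 1 ∨ ε = -1)
    {F : Multiflag n} (hF : F ∈ sectionBase κ.1) : multiflagMap (sheetInv κ ε F) = F := by
  obtain ⟨f, rfl, hf⟩ := hF
  obtain ⟨hmem, heq⟩ := spinorSection_spec κ.1 f hf
  have hε0 : ε ≠ 0 := by rcases hε with rfl | rfl <;> norm_num
  rw [← heq, eq_comm, multiflagMap_eq_multiflagMap_iff, heq, sheetInv_mk κ hε0 f hf]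
  rcases hε with rfl | rfl
  · exact Or.inl (one_smul _ _)
  · exact Or.inr (neg_one_smul _ _)

theorem hasSmoothInverse_sheet (κ : spinorSet n) {ε : ℝ} (hε : ε = 1 ∨ ε = -1) :
    HasSmoothInverse multiflagMap (sheet κ.1 ε) (sectionBase κ.1) := by
  have hε0 : ε ≠ 0 := by rcases hε with rfl | rfl <;> norm_num
  have hεε : ε * ε = 1 := by rcases hε with rfl | rfl <;> norm_num
  have hmaps : Set.MapsTo (sheetInv κ ε) (sectionBase κ.1) (sheet κ.1 ε) := by
    intro F hF
    have h1 := multiflagMap_sheetInv κ hε hF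
    refine ⟨by rwa [h1], ?_⟩
    obtain ⟨f, rfl, hf⟩ := hF
    rw [sheetInv_mk κ hε0 f hf, smul_smul, hεε, one_smul]
    exact spinorSection_congr κ.1 h1
  have hinv : Set.InvOn (sheetInv κ ε) multiflagMap (sheet κ.1 ε) (sectionBase κ.1) := by
    refine ⟨fun μ hμ => Subtype.ext ?_, fun F hF => multiflagMap_sheetInv κ hε hF⟩
    rw [multiflagMap, sheetInv_mk κ hε0 _ (mk_mem_sectionBase.mp hμ.1), hμ.2, smul_smul, hεε,
      one_smul]
  refine ⟨hinv.bijOn (fun μ hμ => hμ.1) hmaps, sheetInv κ ε, hmaps, hinv, fun x => ?_⟩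
  refine ⟨sectionDomain κ.1, isOpen_sectionDomain κ.1, ?_, fun f => ε • spinorSection κ.1 f,
    (contDiffOn_spinorSection κ.1).const_smul ε, fun y hy => ?_⟩
  · obtain ⟨h, hx⟩ := x.2
    exact mk_mem_sectionBase.mp hx
  · exact (sheetInv_mk κ hε0 ⟨y.1, y.2.1⟩ hy).symm

theorem isSmoothDoubleCover_multiflagMap : IsSmoothDoubleCover (multiflagMap (n := n)) where
  smooth := smoothToMultiflag_multiflagMap
  evenlyCovered F := by
    obtain ⟨f, rfl⟩ := Quotient.exists_rep F
    obtain ⟨κ, hκ⟩ := exists_multiflagMap_eq f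
    refine ⟨sectionBase κ.1, isOpen_sectionBase κ.1,
      mk_mem_sectionBase.mpr (mem_sectionDomain_self hκ), sheet κ.1 1, sheet κ.1 (-1),
      isOpen_sheet κ.1 (Or.inl rfl), isOpen_sheet κ.1 (Or.inr rfl), ?_, ?_,
      hasSmoothInverse_sheet κ (Or.inl rfl), hasSmoothInverse_sheet κ (Or.inr rfl)⟩
    · rw [Set.disjoint_left]
      rintro μ ⟨-, h1⟩ ⟨-, h2⟩
      rw [h1, one_smul, neg_one_smul] at h2
      have h3 : (2 : ℝ) • μ.1 = 0 := by
        rw [two_smul]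
        nth_rewrite 1 [h2]
        exact neg_add_cancel _
      exact μ.2.2.2.1 ((smul_eq_zero.mp h3).resolve_left two_ne_zero)
    · ext μ
      constructor
      · rintro (h | h)
        exacts [h.1, h.1]
      · intro h
        rcases spinorSection_spinorFrame κ.1 h with h1 | h1
        · exact Or.inl ⟨h, by rw [h1, one_smul]⟩
        · exact Or.inr ⟨h, by rw [h1, neg_one_smul]⟩

theorem isSpinorFrame_spinorFrame (κ : spinorSet n) : IsSpinorFrame κ (spinorFrame κ) := by
  obtain ⟨h1, h2, -⟩ := spinorFrame_spec κ
  exact ⟨h1, fun j => (h2 j).trans (fderiv_outer κ.1 _).symm⟩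

end DoubleCover
end LipschitzSpinors

theorem mainTheorem6 (n : ℕ) :
    ∃ Φ : spinorSet n → Multiflag n,
      (∀ κ, ∃ f : frameSet n, IsSpinorFrame κ f ∧ Φ κ = ⟦f⟧) ∧
      IsSmoothDoubleCover Φ ∧
      ∀ κ₁ κ₂ : spinorSet n, Φ κ₁ = Φ κ₂ ↔
        (κ₂ : Fin 2 → Cl n) = κ₁ ∨ (κ₂ : Fin 2 → Cl n) = -κ₁ :=
  ⟨multiflagMap, fun κ => ⟨spinorFrame κ, isSpinorFrame_spinorFrame κ, rfl⟩,
    isSmoothDoubleCover_multiflagMap, multiflagMap_eq_multiflagMap_iff⟩
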